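/- For a finite or infinite family $\mathcal F$ of real polynomials in $x_1,\dots,x_n$, a *degree-$r$ Positivstellensatz refutation* (a $\mathsf{PS}(r)$ refutation) of the system $\{f=0 : f\in\mathcal F\}$ is a polynomial identity $$\sum_{i=1}^m f_i g_i = 1+\sum_{j=1}^N h_j^2$$ with $f_1,\dots,f_m\in\mathcal F$ and real polynomials $g_i,h_j$ in $x_1,\dots,x_n$ satisfying $\deg(f_ig_i)\le 2r$ for all $i$ and $\deg(h_j)\le r$ for all $j$. For a graph $G$ on $[n]$ and an integer $k\ge 0$, let $\mathrm{Clique}(G,k)$ be the system given by the polynomials $x_i^2-x_i$ ($i\in[n]$), $x_ix_j$ (for all pairs $i\ne j$ with $\{i,j\}\notin G$), and $\sum_{i=1}^n x_i-k$. **Theorem.** There is a universal constant $C>0$ such that the following holds. For every $\varepsilon>0$ there is $n_0$ such that for all $n\ge n_0$ and all integers $r\ge 1$, with probability at least $1-\varepsilon$ over $G\leftarrow G(n,1/2)$, for every integer $k\ge 0$ with $$k\le \frac{n^{1/(2r)}}{C^{r}(\log n)^{1/r}}$$ the system $\mathrm{Clique}(G,k)$ has no $\mathsf{PS}(r)$ refutation.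 -/

import Mathlib

/-- The family of polynomials `F` (read as the system `f = 0` for `f ∈ F`) has a
Positivstellensatz refutation of degree `r`: an identity `∑ᵢ fᵢ gᵢ = 1 + ∑ⱼ hⱼ²` of real
polynomials with finitely many axioms `fᵢ ∈ F`, `deg (fᵢ gᵢ) ≤ 2r` and `deg hⱼ ≤ r`. -/
def HasPSRefutation {σ : Type*} (F : Set (MvPolynomial σ ℝ)) (r : ℕ) : Prop :=
  ∃ (m : ℕ) (f g : Fin m → MvPolynomial σ ℝ) (N : ℕ) (h : Fin N → MvPolynomial σ ℝ),
    (∀ i, f i ∈ F) ∧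
    (∀ i, (f i * g i).totalDegree ≤ 2 * r) ∧
    (∀ j, (h j).totalDegree ≤ r) ∧
    ∑ i, f i * g i = 1 + ∑ j, h j ^ 2

/-- The axioms `Clique(G, k)`: `xᵢ² - xᵢ` for every vertex, `xᵢ xⱼ` for every pair of distinct
non-adjacent vertices, and `∑ᵢ xᵢ - k`. -/
def cliqueAxioms {n : ℕ} (G : SimpleGraph (Fin n)) (k : ℕ) : Set (MvPolynomial (Fin n) ℝ) :=
  {p | (∃ i, p = MvPolynomial.X i ^ 2 - MvPolynomial.X i) ∨
    (∃ i j, i ≠ j ∧ ¬ G.Adj i j ∧ p = MvPolynomial.X i * MvPolynomial.X j) ∨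
    p = (∑ i, MvPolynomial.X i) - MvPolynomial.C (k : ℝ)}

/-- The parameter `1/2` of the random graph, as a point of the unit interval. -/
noncomputable def edgeProbHalf : unitInterval := ⟨1 / 2, by norm_num, by norm_num⟩

/-!
The refutations are excluded by a pseudo-expectation: a linear functional on polynomials that is
positive at `1`, vanishes on all multiples of the axioms of degree at most `2r`, and is nonnegative
on squares of polynomials of degree at most `r`. Its value at a monomial with support `U` is
`k (k - 1) ⋯ (k - |U| + 1)` times the number of ordered extensions of the clique `U` to a
`2r`-clique (`cliqueMoment`, `pseudoExp`); with these weights the axiom `∑ᵢ xᵢ = k` holds exactly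
(`sum_cliqueMoment_insert`). Modulo that axiom every polynomial of degree at most `r` is homogeneous
and multilinear, so positivity is a statement about the matrix of the moments of `I ∪ J` for
`r`-sets `I`, `J`.

For cliques `I`, `J` with `I ∩ J = K`, the moment of `I ∪ J` is the indicator that `I \ K` and
`J \ K` are completely joined, times an extension count. Replacing the extension count and the
indicator by their means, and dropping the condition that `I \ K` and `J \ K` are disjoint, turns
the quadratic form into `∑_K c_K (∑_{I ⊇ K} d_I)²` with `c_K ≥ 0`. The terms with `|K| = r` form
the diagonal part `c ∑ d_I²`, where `c` is of order `(k n)^r`. The errors of both replacements are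
controlled by a single quantity `η`:

* if all common neighbourhoods of at most `2r` vertices have the expected size up to `η`, then the
  counts of extensions by `i` vertices have the expected size up to `i η n^(i - 1)`, since they are
  iterated sums over common neighbourhoods (`abs_extCount_sub_extMean_le`);
* if the matrix with entries `[x ~ y] - 1/2` has norm at most `η`, the edges of the complete join
  can be replaced by `1/2` one at a time. After freezing all vertices but the two ends of the edge,
  the other indicators factor into a function of one end times a function of the other, so each
  replacement costs a factor `η / n` (`abs_sum_tuple_edge_le`).

Altogether the error is at most `C^(r²) k^(2r) η n^(r - 1)`, which is below the diagonal part when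
`C^(r²) k^r η ≤ n` (`moment_quadratic_form_nonneg`). In the random graph `η = √n log n` works, by
exponential moments: a symmetrization by edge flips (`sum_exp_le_of_flips`) gives the subgaussian
tails, and union bounds over the vertex sets and over a grid in the unit ball finish the proof.
For `k < 2r` the moments are not needed, as there is a clique of size `k`.
-/

/-! ### Clique extensions and the pseudo-moments -/

/-- The common neighbourhood of a vertex set; it is disjoint from the set. -/
noncomputable def commonNbrs {V : Type*} [Fintype V] (G : SimpleGraph V) (W : Finset V) :
    Finset V :=
  open Classical in Finset.univ.filter fun v => ∀ w ∈ W, G.Adj w v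

/-- The number of ordered `i`-tuples of pairwise adjacent vertices in the common neighbourhood
of `W`. If `W` is a clique, these are the ordered extensions of `W` to a clique with `i` more
vertices. -/
noncomputable def extCount {V : Type*} [Fintype V] [DecidableEq V] (G : SimpleGraph V) :
    ℕ → Finset V → ℝ
  | 0, _ => 1
  | i + 1, W => ∑ v ∈ commonNbrs G W, extCount G i (insert v W)

/-- The pseudo-moment of the monomial with support `U`: the indicator of `U` being a clique,
weighted by `k (k - 1) ⋯ (k - |U| + 1)` and by the number of ordered extensions of `U` to a
`D`-clique. -/
noncomputable def cliqueMoment {V : Type*} [Fintype V] [DecidableEq V] (G : SimpleGraph V)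
    (k D : ℕ) (U : Finset V) : ℝ :=
  open Classical in
  if G.IsClique (U : Set V) then (k.descFactorial U.card : ℝ) * extCount G (D - U.card) U else 0

section Moments

variable {V : Type*} [Fintype V] {G : SimpleGraph V}

lemma mem_commonNbrs {W : Finset V} {v : V} : v ∈ commonNbrs G W ↔ ∀ w ∈ W, G.Adj w v := by
  classical
  simp [commonNbrs]

lemma notMem_of_mem_commonNbrs {W : Finset V} {v : V} (hv : v ∈ commonNbrs G W) : v ∉ W :=
  fun h => G.irrefl (mem_commonNbrs.1 hv v h)

variable [DecidableEq V]

lemma isClique_insert_iff {U : Finset V} {v : V} (hv : v ∉ U) :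
    G.IsClique ((insert v U : Finset V) : Set V) ↔
      G.IsClique (U : Set V) ∧ v ∈ commonNbrs G U := by
  rw [Finset.coe_insert, SimpleGraph.isClique_insert_of_notMem (by simpa using hv)]
  simp [mem_commonNbrs, G.adj_comm]

/-- A positive number of extensions produces a clique with the prescribed number of vertices. -/
lemma exists_isClique_of_extCount_pos (i : ℕ) (W : Finset V) (hW : G.IsClique (W : Set V))
    (h : 0 < extCount G i W) :
    ∃ T : Finset V, G.IsClique (T : Set V) ∧ T.card = W.card + i := by
  induction i generalizing W with
  | zero => exact ⟨W, hW, by simp⟩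
  | succ i ih =>
    obtain ⟨v, hv, hpos⟩ : ∃ v ∈ commonNbrs G W, 0 < extCount G i (insert v W) := by
      by_contra! hcon
      exact absurd h (not_lt.2 (Finset.sum_nonpos hcon))
    have hvW := notMem_of_mem_commonNbrs hv
    obtain ⟨T, hT, hc⟩ := ih (insert v W) ((isClique_insert_iff hvW).2 ⟨hW, hv⟩) hpos
    exact ⟨T, hT, by rw [hc, Finset.card_insert_of_notMem hvW]; omega⟩

/-- The pseudo-moments satisfy the axiom `∑ᵢ xᵢ = k` exactly below degree `D`. -/
lemma sum_cliqueMoment_insert (k D : ℕ) (U : Finset V) (hU : U.card < D) :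
    ∑ v, cliqueMoment G k D (insert v U) = k * cliqueMoment G k D U := by
  classical
  have hout : ∑ v ∈ Uᶜ, cliqueMoment G k D (insert v U) =
      ((k : ℝ) - U.card) * cliqueMoment G k D U := by
    by_cases hc : G.IsClique (U : Set V)
    · have h1 : ∀ v ∈ Uᶜ, cliqueMoment G k D (insert v U) = if v ∈ commonNbrs G U then
          (k.descFactorial (U.card + 1) : ℝ) * extCount G (D - (U.card + 1)) (insert v U)
          else 0 := by
        intro v hv
        have hv' : v ∉ U := by simpa using hv
        rw [cliqueMoment, Finset.card_insert_of_notMem hv']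
        exact if_congr (by rw [isClique_insert_iff hv']; exact and_iff_right hc) rfl rfl
      have h2 : Uᶜ.filter (· ∈ commonNbrs G U) = commonNbrs G U := by
        ext v
        simp only [Finset.mem_filter, Finset.mem_compl, and_iff_right_iff_imp]
        exact notMem_of_mem_commonNbrs
      have h3 : D - U.card = (D - (U.card + 1)) + 1 := by omega
      rw [Finset.sum_congr rfl h1, ← Finset.sum_filter, h2, ← Finset.mul_sum, cliqueMoment,
        if_pos hc, h3, extCount, Nat.descFactorial_succ, Nat.cast_mul]
      rcases le_or_gt U.card k with hk | hk
      · rw [Nat.cast_sub hk]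
        ring
      · simp [Nat.descFactorial_eq_zero_iff_lt.2 hk]
    · rw [cliqueMoment, if_neg hc, mul_zero]
      refine Finset.sum_eq_zero fun v hv => ?_
      rw [cliqueMoment, if_neg]
      rw [isClique_insert_iff (by simpa using hv)]
      tauto
  have hin : ∑ v ∈ U, cliqueMoment G k D (insert v U) = U.card * cliqueMoment G k D U := by
    rw [Finset.sum_congr rfl fun v hv => by rw [Finset.insert_eq_of_mem hv]]
    simp
  rw [← Finset.sum_add_sum_compl U, hin, hout]
  ring

/-- Modulo `∑ᵢ xᵢ = k`, a monomial of degree at most `r` is a combination of multilinear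
monomials of degree exactly `r`. -/
lemma exists_homogenization (k r : ℕ) (hk : r ≤ k) (S : Finset V) (hS : S.card ≤ r) :
    ∃ w : Finset V → ℝ, ∀ J : Finset V, J.card ≤ r → cliqueMoment G k (2 * r) (S ∪ J) =
      ∑ I ∈ Finset.powersetCard r Finset.univ, w I * cliqueMoment G k (2 * r) (I ∪ J) := by
  obtain ⟨m, hm⟩ : ∃ m, S.card + m = r := ⟨r - S.card, by omega⟩
  induction m generalizing S with
  | zero =>
    refine ⟨fun I => if I = S then 1 else 0, fun J _ => ?_⟩
    simp only [ite_mul, one_mul, zero_mul, Finset.sum_ite_eq']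
    rw [if_pos (by simp [Finset.mem_powersetCard]; omega)]
  | succ m ih =>
    have hex : ∀ v, ∃ w : Finset V → ℝ, v ∉ S → ∀ J : Finset V, J.card ≤ r →
        cliqueMoment G k (2 * r) (insert v S ∪ J) =
          ∑ I ∈ Finset.powersetCard r Finset.univ, w I * cliqueMoment G k (2 * r) (I ∪ J) := by
      intro v
      by_cases hv : v ∈ S
      · exact ⟨0, fun h => absurd hv h⟩
      · have hcard := Finset.card_insert_of_notMem hv
        obtain ⟨w, hw⟩ := ih (insert v S) (by omega) (by omega)
        exact ⟨w, fun _ => hw⟩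
    choose w hw using hex
    have hpos : (0 : ℝ) < (k : ℝ) - S.card := by
      have : S.card < k := by omega
      have : (S.card : ℝ) < k := by exact_mod_cast this
      linarith
    refine ⟨fun I => ((k : ℝ) - S.card)⁻¹ * ∑ v ∈ Sᶜ, w v I, fun J hJ => ?_⟩
    have hU : (S ∪ J).card < 2 * r := by
      have := Finset.card_union_le S J
      omega
    have h1 := sum_cliqueMoment_insert (G := G) k (2 * r) (S ∪ J) hU
    rw [← Finset.sum_add_sum_compl S, Finset.sum_congr rfl (g := fun _ =>
      cliqueMoment G k (2 * r) (S ∪ J)) fun v hv => by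
        rw [Finset.insert_eq_of_mem (Finset.mem_union_left _ hv)]] at h1
    have h2 : ∑ v ∈ Sᶜ, cliqueMoment G k (2 * r) (insert v (S ∪ J)) =
        ((k : ℝ) - S.card) * cliqueMoment G k (2 * r) (S ∪ J) := by
      simp only [Finset.sum_const, nsmul_eq_mul] at h1
      linarith
    have h3 : ∑ v ∈ Sᶜ, cliqueMoment G k (2 * r) (insert v (S ∪ J)) =
        ∑ I ∈ Finset.powersetCard r Finset.univ,
          (∑ v ∈ Sᶜ, w v I) * cliqueMoment G k (2 * r) (I ∪ J) := by
      simp_rw [Finset.sum_mul]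
      rw [Finset.sum_comm]
      refine Finset.sum_congr rfl fun v hv => ?_
      rw [← Finset.insert_union]
      exact hw v (by simpa using hv) J hJ
    simp only [mul_assoc]
    rw [← Finset.mul_sum, ← h3, h2, inv_mul_cancel_left₀ hpos.ne']

end Moments

/-! ### The pseudo-expectation and refutations -/

/-- The linear functional on polynomials whose value at a monomial is the pseudo-moment of its
support. -/
noncomputable def pseudoExp {V : Type*} [Fintype V] [DecidableEq V] (G : SimpleGraph V)
    (k D : ℕ) : MvPolynomial V ℝ →ₗ[ℝ] ℝ :=
  (MvPolynomial.basisMonomials V ℝ).constr ℝ fun m => cliqueMoment G k D m.support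

section PseudoExp

open MvPolynomial

lemma support_single_add {V : Type*} [DecidableEq V] (i : V) (m : V →₀ ℕ) {e : ℕ} (he : e ≠ 0) :
    (Finsupp.single i e + m).support = insert i m.support := by
  ext j
  by_cases h : j = i
  · subst h
    simp [he]
  · simp [h]

lemma card_support_le_of_mem_support {V : Type*} {g : MvPolynomial V ℝ} {m : V →₀ ℕ}
    (hm : m ∈ g.support) :
    m.support.card ≤ g.totalDegree := by
  refine le_trans ?_ (le_totalDegree hm)
  rw [Finset.card_eq_sum_ones]
  exact Finset.sum_le_sum fun i hi => Nat.one_le_iff_ne_zero.2 (by simpa using hi)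

variable {V : Type*} [Fintype V] [DecidableEq V] {G : SimpleGraph V}

lemma pseudoExp_monomial (k D : ℕ) (m : V →₀ ℕ) (c : ℝ) :
    pseudoExp G k D (monomial m c) = c * cliqueMoment G k D m.support := by
  have h : monomial m c = c • (basisMonomials V ℝ m) := by
    rw [coe_basisMonomials, smul_monomial, smul_eq_mul, mul_one]
  rw [h, map_smul, pseudoExp, Module.Basis.constr_basis, smul_eq_mul]

/-- To kill all multiples `f * g` it is enough to kill the multiples of `f` by the monomials
of `g`. -/
lemma pseudoExp_mul_eq_zero (k D : ℕ) (f g : MvPolynomial V ℝ)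
    (h : ∀ m ∈ g.support, pseudoExp G k D (f * monomial m 1) = 0) :
    pseudoExp G k D (f * g) = 0 := by
  conv_lhs => rw [g.as_sum, Finset.mul_sum, map_sum]
  refine Finset.sum_eq_zero fun m hm => ?_
  have : monomial m (coeff m g) = coeff m g • (monomial m (1 : ℝ)) := by
    rw [smul_monomial, smul_eq_mul, mul_one]
  rw [this, mul_smul_comm, map_smul, h m hm, smul_zero]

lemma pseudoExp_square_axiom (k D : ℕ) (i : V) (g : MvPolynomial V ℝ) :
    pseudoExp G k D ((X i ^ 2 - X i) * g) = 0 := by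
  refine pseudoExp_mul_eq_zero k D _ g fun m _ => ?_
  rw [sub_mul, X_pow_eq_monomial, X, monomial_mul, monomial_mul, map_sub, pseudoExp_monomial,
    pseudoExp_monomial, support_single_add i m two_ne_zero, support_single_add i m one_ne_zero,
    sub_self]

lemma pseudoExp_nonedge_axiom (k D : ℕ) {i j : V} (hij : i ≠ j) (hG : ¬ G.Adj i j)
    (g : MvPolynomial V ℝ) : pseudoExp G k D (X i * X j * g) = 0 := by
  refine pseudoExp_mul_eq_zero k D _ g fun m _ => ?_
  rw [mul_assoc, X, X, monomial_mul, monomial_mul, pseudoExp_monomial,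
    support_single_add i _ one_ne_zero, support_single_add j _ one_ne_zero, cliqueMoment,
    if_neg, mul_zero]
  intro h
  exact hG (h (by simp) (by simp) hij)

lemma pseudoExp_sum_axiom [Nonempty V] (k D : ℕ) (g : MvPolynomial V ℝ)
    (hdeg : (((∑ i, X i) - C (k : ℝ)) * g).totalDegree ≤ D) :
    pseudoExp G k D (((∑ i, X i) - C (k : ℝ)) * g) = 0 := by
  by_cases hg : g = 0
  · simp [hg]
  obtain ⟨i₀⟩ := ‹Nonempty V›
  set f : MvPolynomial V ℝ := (∑ i, X i) - C (k : ℝ) with hf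
  have hcoeff : coeff (Finsupp.single i₀ 1) f = 1 := by
    rw [hf, coeff_sub, coeff_sum, coeff_C, if_neg (by
      intro h
      simpa using congrArg (fun m => m i₀) h), sub_zero]
    rw [Finset.sum_eq_single i₀]
    · simp [coeff_X]
    · intro j _ hj
      rw [coeff_X, if_neg]
      intro h
      exact hj (Finsupp.single_left_injective one_ne_zero h)
    · simp
  have hf1 : 1 ≤ f.totalDegree := by
    have := le_totalDegree (p := f) (s := Finsupp.single i₀ 1) (by simp [hcoeff])
    simpa using this
  have hf0 : f ≠ 0 := by
    intro h
    simp [h] at hf1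
  rw [totalDegree_mul_of_isDomain hf0 hg] at hdeg
  refine pseudoExp_mul_eq_zero k D _ g fun m hm => ?_
  have hlt : m.support.card < D := by
    have := card_support_le_of_mem_support hm
    omega
  rw [hf, sub_mul, Finset.sum_mul, map_sub, map_sum]
  have h1 : ∀ i : V, pseudoExp G k D (X i * monomial m 1) =
      cliqueMoment G k D (insert i m.support) := by
    intro i
    rw [X, monomial_mul, pseudoExp_monomial, support_single_add i m one_ne_zero]
    simp
  rw [Finset.sum_congr rfl fun i _ => h1 i, sum_cliqueMoment_insert k D _ hlt, C_mul_monomial,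
    pseudoExp_monomial, mul_one, sub_self]

/-- Positivity of the moment matrix on the multilinear monomials of degree exactly `r` gives
positivity of the pseudo-expectation on all squares of polynomials of degree at most `r`. -/
lemma pseudoExp_sq_nonneg (k r : ℕ) (hk : r ≤ k)
    (hpos : ∀ d : Finset V → ℝ, 0 ≤ ∑ I ∈ Finset.powersetCard r Finset.univ,
      ∑ J ∈ Finset.powersetCard r Finset.univ, d I * d J * cliqueMoment G k (2 * r) (I ∪ J))
    (h : MvPolynomial V ℝ) (hh : h.totalDegree ≤ r) : 0 ≤ pseudoExp G k (2 * r) (h ^ 2) := by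
  have hex : ∀ m : V →₀ ℕ, ∃ w : Finset V → ℝ, m ∈ h.support → ∀ J : Finset V, J.card ≤ r →
      cliqueMoment G k (2 * r) (m.support ∪ J) =
        ∑ I ∈ Finset.powersetCard r Finset.univ, w I * cliqueMoment G k (2 * r) (I ∪ J) := by
    intro m
    by_cases hm : m ∈ h.support
    · obtain ⟨w, hw⟩ := exists_homogenization (G := G) k r hk m.support
        ((card_support_le_of_mem_support hm).trans hh)
      exact ⟨w, fun _ => hw⟩
    · exact ⟨0, fun h => absurd h hm⟩
  choose w hw using hex
  have key := hpos fun I => ∑ m ∈ h.support, coeff m h * w m I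
  have hval : pseudoExp G k (2 * r) (h ^ 2) = ∑ m ∈ h.support, ∑ m' ∈ h.support,
      coeff m h * coeff m' h * cliqueMoment G k (2 * r) (m.support ∪ m'.support) := by
    conv_lhs => rw [sq, h.as_sum, Finset.sum_mul_sum, map_sum]
    refine Finset.sum_congr rfl fun m _ => ?_
    rw [map_sum]
    refine Finset.sum_congr rfl fun m' _ => ?_
    rw [monomial_mul, pseudoExp_monomial]
    congr 2
    ext i
    simp only [Finsupp.mem_support_iff, Finsupp.add_apply, Finset.mem_union]
    omega
  have hterm : ∀ m ∈ h.support, ∀ m' ∈ h.support,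
      cliqueMoment G k (2 * r) (m.support ∪ m'.support) =
        ∑ I ∈ Finset.powersetCard r Finset.univ, ∑ J ∈ Finset.powersetCard r Finset.univ,
          w m I * w m' J * cliqueMoment G k (2 * r) (I ∪ J) := by
    intro m hm m' hm'
    rw [hw m hm _ ((card_support_le_of_mem_support hm').trans hh)]
    refine Finset.sum_congr rfl fun I hI => ?_
    rw [Finset.union_comm, hw m' hm' I (Finset.mem_powersetCard.1 hI).2.le, Finset.mul_sum]
    refine Finset.sum_congr rfl fun J _ => ?_
    rw [Finset.union_comm J I]
    ring
  rw [hval]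
  refine key.trans_eq ?_
  have hR : ∑ m ∈ h.support, ∑ m' ∈ h.support, coeff m h * coeff m' h *
      cliqueMoment G k (2 * r) (m.support ∪ m'.support) =
      ∑ m ∈ h.support, ∑ m' ∈ h.support, ∑ I ∈ Finset.powersetCard r Finset.univ,
        ∑ J ∈ Finset.powersetCard r Finset.univ, coeff m h * w m I * (coeff m' h * w m' J) *
          cliqueMoment G k (2 * r) (I ∪ J) := by
    refine Finset.sum_congr rfl fun m hm => Finset.sum_congr rfl fun m' hm' => ?_
    rw [hterm m hm m' hm', Finset.mul_sum]
    refine Finset.sum_congr rfl fun I _ => ?_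
    rw [Finset.mul_sum]
    exact Finset.sum_congr rfl fun J _ => by ring
  rw [hR]
  simp_rw [Finset.sum_mul_sum, Finset.sum_mul]
  rw [Finset.sum_congr rfl fun I _ => Finset.sum_comm, Finset.sum_comm]
  refine Finset.sum_congr rfl fun m _ => ?_
  rw [Finset.sum_congr rfl fun I _ => Finset.sum_comm, Finset.sum_comm]

/-- The pseudo-expectation certifies that there is no refutation. -/
lemma not_hasPSRefutation_of_moment_psd {n : ℕ} [Nonempty (Fin n)] {G : SimpleGraph (Fin n)}
    (k r : ℕ) (hk : r ≤ k) (hone : 0 < extCount G (2 * r) ∅)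
    (hpos : ∀ d : Finset (Fin n) → ℝ, 0 ≤ ∑ I ∈ Finset.powersetCard r Finset.univ,
      ∑ J ∈ Finset.powersetCard r Finset.univ, d I * d J * cliqueMoment G k (2 * r) (I ∪ J)) :
    ¬ HasPSRefutation (cliqueAxioms G k) r := by
  rintro ⟨m, f, g, N, h, hf, hfg, hh, heq⟩
  have h1 : pseudoExp G k (2 * r) (∑ i, f i * g i) = 0 := by
    rw [map_sum]
    refine Finset.sum_eq_zero fun i _ => ?_
    have hdeg := hfg i
    rcases hf i with ⟨a, ha⟩ | ⟨a, b, hab, hG, ha⟩ | ha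
    · rw [ha]
      exact pseudoExp_square_axiom _ _ _ _
    · rw [ha]
      exact pseudoExp_nonedge_axiom _ _ hab hG _
    · rw [ha] at hdeg ⊢
      exact pseudoExp_sum_axiom _ _ _ hdeg
  have h2 : pseudoExp G k (2 * r) 1 = extCount G (2 * r) ∅ := by
    rw [← C_1, C_apply, pseudoExp_monomial]
    simp [cliqueMoment]
  rw [heq, map_add, map_sum, h2] at h1
  have h3 : 0 ≤ ∑ j, pseudoExp G k (2 * r) (h j ^ 2) :=
    Finset.sum_nonneg fun j _ => pseudoExp_sq_nonneg k r hk hpos (h j) (hh j)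
  linarith

/-- An actual clique of size `k` satisfies all axioms, so there is no refutation. -/
lemma not_hasPSRefutation_of_isClique {n : ℕ} {G : SimpleGraph (Fin n)} (r : ℕ)
    (T : Finset (Fin n)) (hT : G.IsClique (T : Set (Fin n))) :
    ¬ HasPSRefutation (cliqueAxioms G T.card) r := by
  rintro ⟨m, f, g, N, h, hf, -, -, heq⟩
  have h1 := congrArg (eval fun i => if i ∈ T then (1 : ℝ) else 0) heq
  rw [map_sum, map_add, map_one, map_sum, Finset.sum_eq_zero] at h1
  · have : 0 ≤ ∑ j, eval (fun i => if i ∈ T then (1 : ℝ) else 0) (h j ^ 2) :=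
      Finset.sum_nonneg fun j _ => by rw [map_pow]; positivity
    linarith
  · intro i _
    rw [map_mul]
    refine mul_eq_zero_of_left ?_ _
    rcases hf i with ⟨a, ha⟩ | ⟨a, b, hab, hG, ha⟩ | ha
    · rw [ha]
      simp
    · rw [ha]
      simp only [map_mul, eval_X, mul_ite, mul_one, mul_zero, ite_eq_right_iff, one_ne_zero,
        imp_false]
      exact fun hb ha' => hG (hT ha' hb hab)
    · rw [ha]
      simp

end PseudoExp

/-! ### Concentration of extension counts -/

/-- The value of `extCount` at a set with `w` elements in an idealized graph on `n` vertices, in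
which every set `W` has exactly `n / 2 ^ |W|` common neighbours. -/
noncomputable def extMean (n : ℝ) : ℕ → ℕ → ℝ
  | 0, _ => 1
  | i + 1, w => n / 2 ^ w * extMean n i (w + 1)

lemma extMean_nonneg {n : ℝ} (hn : 0 ≤ n) (i w : ℕ) : 0 ≤ extMean n i w := by
  induction i generalizing w with
  | zero => simp [extMean]
  | succ i ih => exact mul_nonneg (by positivity) (ih _)

lemma extMean_le {n : ℝ} (hn : 0 ≤ n) (i w : ℕ) : extMean n i w ≤ n ^ i := by
  induction i generalizing w with
  | zero => simp [extMean]
  | succ i ih =>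
    rw [extMean, pow_succ']
    refine mul_le_mul (div_le_self hn (one_le_pow₀ one_le_two)) (ih _) (extMean_nonneg hn _ _) hn

lemma le_extMean {n : ℝ} (hn : 0 ≤ n) (D i w : ℕ) (h : w + i ≤ D) :
    (n / 2 ^ D) ^ i ≤ extMean n i w := by
  induction i generalizing w with
  | zero => simp [extMean]
  | succ i ih =>
    rw [extMean, pow_succ']
    refine mul_le_mul ?_ (ih _ (by omega)) (by positivity) (by positivity)
    exact div_le_div_of_nonneg_left hn (by positivity)
      (pow_le_pow_right₀ one_le_two (by omega))

section Concentration

variable {V : Type*} [Fintype V] [DecidableEq V] {G : SimpleGraph V}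

/-- If all common neighbourhoods of at most `D` vertices have the expected size up to `η`, then
all extension counts are close to their idealized values. -/
lemma abs_extCount_sub_extMean_le {η : ℝ} {D : ℕ} (hη : 0 ≤ η)
    (hB : ∀ W : Finset V, W.card ≤ D →
      |((commonNbrs G W).card : ℝ) - Fintype.card V / 2 ^ W.card| ≤ η)
    (i : ℕ) (W : Finset V) (hW : W.card + i ≤ D) :
    |extCount G i W - extMean (Fintype.card V) i W.card| ≤
      i * η * (Fintype.card V : ℝ) ^ (i - 1) := by
  induction i generalizing W with
  | zero => simp [extCount, extMean]
  | succ i ih =>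
    set n : ℝ := (Fintype.card V : ℝ) with hn
    have hn0 : 0 ≤ n := by positivity
    have hcard : ((commonNbrs G W).card : ℝ) ≤ n := by
      rw [hn]
      exact_mod_cast Finset.card_le_univ (commonNbrs G W)
    have h1 : |∑ v ∈ commonNbrs G W, (extCount G i (insert v W) - extMean n i (W.card + 1))| ≤
        i * η * n ^ i := by
      calc |∑ v ∈ commonNbrs G W, (extCount G i (insert v W) - extMean n i (W.card + 1))|
          ≤ ∑ v ∈ commonNbrs G W, |extCount G i (insert v W) - extMean n i (W.card + 1)| :=
            Finset.abs_sum_le_sum_abs _ _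
        _ ≤ ∑ v ∈ commonNbrs G W, i * η * n ^ (i - 1) := by
            refine Finset.sum_le_sum fun v hv => ?_
            have hc := Finset.card_insert_of_notMem (notMem_of_mem_commonNbrs hv)
            have := ih (insert v W) (by omega)
            rwa [hc] at this
        _ = (commonNbrs G W).card * (i * η * n ^ (i - 1)) := by simp
        _ ≤ n * (i * η * n ^ (i - 1)) := by gcongr
        _ = i * η * n ^ i := by
            rcases i with _ | i
            · simp
            · rw [Nat.add_sub_cancel, pow_succ]
              ring
    have h2 : |(((commonNbrs G W).card : ℝ) - n / 2 ^ W.card) * extMean n i (W.card + 1)| ≤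
        η * n ^ i := by
      rw [abs_mul, abs_of_nonneg (extMean_nonneg hn0 _ _)]
      exact mul_le_mul (hB W (by omega)) (extMean_le hn0 _ _) (extMean_nonneg hn0 _ _) hη
    have h3 : extCount G (i + 1) W - extMean n (i + 1) W.card =
        ∑ v ∈ commonNbrs G W, (extCount G i (insert v W) - extMean n i (W.card + 1)) +
        (((commonNbrs G W).card : ℝ) - n / 2 ^ W.card) * extMean n i (W.card + 1) := by
      rw [Finset.sum_sub_distrib, extCount, extMean]
      simp only [Finset.sum_const, nsmul_eq_mul]
      ring
    rw [h3]
    refine (abs_add_le _ _).trans ((add_le_add h1 h2).trans_eq ?_)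
    push_cast
    ring

end Concentration

/-! ### Bilinear forms over tuples of vertices -/

/-- The adjacency indicator of a graph, as a real number. -/
noncomputable def adjInd {V : Type*} (G : SimpleGraph V) (x y : V) : ℝ :=
  open Classical in if G.Adj x y then 1 else 0

lemma adjInd_nonneg {V : Type*} (G : SimpleGraph V) (x y : V) : 0 ≤ adjInd G x y := by
  unfold adjInd
  split_ifs <;> simp

lemma adjInd_le_one {V : Type*} (G : SimpleGraph V) (x y : V) : adjInd G x y ≤ 1 := by
  unfold adjInd
  split_ifs <;> simp

lemma prod_adjInd_mem_Icc {V α : Type*} (G : SimpleGraph V) (S : Finset α) (f h : α → V) :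
    ∏ e ∈ S, adjInd G (f e) (h e) ∈ Set.Icc (0 : ℝ) 1 :=
  ⟨Finset.prod_nonneg fun _ _ => adjInd_nonneg _ _ _,
    Finset.prod_le_one (fun _ _ => adjInd_nonneg _ _ _) fun _ _ => adjInd_le_one _ _ _⟩

/-- Resampling one coordinate. -/
lemma sum_sum_update {ι V : Type*} [Fintype ι] [DecidableEq ι] [Fintype V] (p : ι)
    (F : (ι → V) → ℝ) :
    ∑ a : ι → V, ∑ x : V, F (Function.update a p x) = Fintype.card V * ∑ a : ι → V, F a := by
  let φ : (ι → V) × V → (ι → V) × V := fun t => (Function.update t.1 p t.2, t.1 p)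
  have hφ : Function.Involutive φ := by
    rintro ⟨a, x⟩
    simp [φ]
  have h := Equiv.sum_comp hφ.toPerm fun t : (ι → V) × V => F t.1
  rw [Fintype.sum_prod_type, Fintype.sum_prod_type] at h
  simp only [Function.Involutive.coe_toPerm, φ] at h
  rw [h, Finset.mul_sum]
  simp

section Bilinear

variable {V ι : Type*} [Fintype V] [Fintype ι] [DecidableEq ι] {G : SimpleGraph V} {η : ℝ}

/-- One step of the telescoping: with all coordinates but the `p`-th of `a` and the `q`-th of `b`
frozen, every other edge factor depends on at most one of the two free coordinates, so the form is
controlled by the matrix with entries `adjInd G x y - 1 / 2`. -/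
lemma abs_sum_tuple_edge_le [Nonempty V]
    (hA : ∀ u v : V → ℝ, |∑ x, ∑ y, u x * v y * (adjInd G x y - 1 / 2)| ≤
      η * ((∑ x, u x ^ 2 + ∑ y, v y ^ 2) / 2))
    (hη : 0 ≤ η) (E : Finset (ι × ι)) (p q : ι) (hpq : (p, q) ∉ E) (u v : (ι → V) → ℝ) :
    |∑ a, ∑ b, u a * v b * ((∏ e ∈ E, adjInd G (a e.1) (b e.2)) *
        (adjInd G (a p) (b q) - 1 / 2))| ≤
      η * (Fintype.card V : ℝ) ^ (Fintype.card ι - 1) * ((∑ a, u a ^ 2 + ∑ b, v b ^ 2) / 2) := by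
  set n : ℝ := (Fintype.card V : ℝ) with hn
  have hn0 : 0 < n := by
    rw [hn]
    exact_mod_cast Fintype.card_pos
  set Φ : (ι → V) → (ι → V) → ℝ := fun a b => u a * v b *
    ((∏ e ∈ E, adjInd G (a e.1) (b e.2)) * (adjInd G (a p) (b q) - 1 / 2)) with hΦ
  -- averaging over the two free coordinates instead of splitting them off the tuples
  have havg : ∑ a, ∑ b, ∑ x, ∑ y, Φ (Function.update a p x) (Function.update b q y) =
      n ^ 2 * ∑ a, ∑ b, Φ a b := by
    calc ∑ a, ∑ b, ∑ x, ∑ y, Φ (Function.update a p x) (Function.update b q y)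
        = ∑ a, ∑ x, ∑ b, ∑ y, Φ (Function.update a p x) (Function.update b q y) :=
          Finset.sum_congr rfl fun a _ => Finset.sum_comm
      _ = ∑ a, ∑ x, n * ∑ b, Φ (Function.update a p x) b :=
          Finset.sum_congr rfl fun a _ => Finset.sum_congr rfl fun x _ => sum_sum_update q _
      _ = n * ∑ a, n * ∑ b, Φ a b := by
          rw [hn]
          exact sum_sum_update p fun a => (Fintype.card V : ℝ) * ∑ b, Φ a b
      _ = n ^ 2 * ∑ a, ∑ b, Φ a b := by
          rw [← Finset.mul_sum, sq, mul_assoc]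
  have hinner : ∀ a b : ι → V,
      |∑ x, ∑ y, Φ (Function.update a p x) (Function.update b q y)| ≤
        η * ((∑ x, u (Function.update a p x) ^ 2 + ∑ y, v (Function.update b q y) ^ 2) / 2) := by
    intro a b
    -- an edge `e ≠ (p, q)` either avoids `q` on the right, or has `e.2 = q` and avoids `p`
    set P : V → ℝ := fun x => ∏ e ∈ E.filter (fun e => e.2 ≠ q),
      adjInd G (Function.update a p x e.1) (b e.2) with hP
    set Q : V → ℝ := fun y => ∏ e ∈ E.filter (fun e => ¬ e.2 ≠ q),
      adjInd G (a e.1) (Function.update b q y e.2) with hQ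
    have hsplit : ∀ x y, ∏ e ∈ E, adjInd G (Function.update a p x e.1)
        (Function.update b q y e.2) = P x * Q y := by
      intro x y
      rw [← Finset.prod_filter_mul_prod_filter_not E (fun e => e.2 ≠ q)]
      congr 1
      · refine Finset.prod_congr rfl fun e he => ?_
        rw [Function.update_of_ne (Finset.mem_filter.1 he).2]
      · refine Finset.prod_congr rfl fun e he => ?_
        obtain ⟨heE, heq⟩ := Finset.mem_filter.1 he
        have heq' : e.2 = q := not_not.1 heq
        have hne : e.1 ≠ p := fun h => hpq (by rwa [← h, ← heq'])
        rw [Function.update_of_ne hne]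
    have hsq : ∀ {c t : ℝ}, t ∈ Set.Icc (0 : ℝ) 1 → (c * t) ^ 2 ≤ c ^ 2 := by
      intro c t ht
      rw [mul_pow]
      exact mul_le_of_le_one_right (sq_nonneg c) (pow_le_one₀ ht.1 ht.2)
    have hform : ∑ x, ∑ y, Φ (Function.update a p x) (Function.update b q y) =
        ∑ x, ∑ y, (u (Function.update a p x) * P x) * (v (Function.update b q y) * Q y) *
          (adjInd G x y - 1 / 2) := by
      refine Finset.sum_congr rfl fun x _ => Finset.sum_congr rfl fun y _ => ?_
      simp only [hΦ]
      rw [hsplit, Function.update_self, Function.update_self]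
      ring
    rw [hform]
    refine (hA _ _).trans ?_
    refine mul_le_mul_of_nonneg_left (div_le_div_of_nonneg_right (add_le_add
      (Finset.sum_le_sum fun x _ => ?_) (Finset.sum_le_sum fun y _ => ?_)) zero_le_two) hη
    · exact hsq (prod_adjInd_mem_Icc G _ _ _)
    · exact hsq (prod_adjInd_mem_Icc G _ _ _)
  have hpow : n ^ Fintype.card ι = n ^ (Fintype.card ι - 1) * n := by
    have : 0 < Fintype.card ι := Fintype.card_pos_iff.2 ⟨p⟩
    rw [← pow_succ]
    congr 1
    omega
  have hcard : ((Finset.univ : Finset (ι → V)).card : ℝ) = n ^ Fintype.card ι := by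
    rw [Finset.card_univ, Fintype.card_fun, Nat.cast_pow]
  have hmain : n ^ 2 * |∑ a, ∑ b, Φ a b| ≤
      n ^ 2 * (η * n ^ (Fintype.card ι - 1) * ((∑ a, u a ^ 2 + ∑ b, v b ^ 2) / 2)) := by
    calc n ^ 2 * |∑ a, ∑ b, Φ a b|
        = |∑ a, ∑ b, ∑ x, ∑ y, Φ (Function.update a p x) (Function.update b q y)| := by
          rw [havg, abs_mul, abs_of_nonneg (by positivity : (0 : ℝ) ≤ n ^ 2)]
      _ ≤ ∑ a, ∑ b, |∑ x, ∑ y, Φ (Function.update a p x) (Function.update b q y)| :=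
          (Finset.abs_sum_le_sum_abs _ _).trans
            (Finset.sum_le_sum fun a _ => Finset.abs_sum_le_sum_abs _ _)
      _ ≤ ∑ a : ι → V, ∑ b : ι → V, η * ((∑ x, u (Function.update a p x) ^ 2 +
            ∑ y, v (Function.update b q y) ^ 2) / 2) :=
          Finset.sum_le_sum fun a _ => Finset.sum_le_sum fun b _ => hinner a b
      _ = η / 2 * (n ^ Fintype.card ι * (∑ a, ∑ x, u (Function.update a p x) ^ 2) +
            n ^ Fintype.card ι * ∑ b, ∑ y, v (Function.update b q y) ^ 2) := by
          have hcong : ∀ a b : ι → V, η * ((∑ x, u (Function.update a p x) ^ 2 +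
              ∑ y, v (Function.update b q y) ^ 2) / 2) =
              η / 2 * (∑ x, u (Function.update a p x) ^ 2) +
              η / 2 * ∑ y, v (Function.update b q y) ^ 2 := fun a b => by ring
          simp_rw [hcong, Finset.sum_add_distrib, Finset.sum_const, nsmul_eq_mul, hcard,
            ← Finset.mul_sum]
          ring
      _ = n ^ 2 * (η * n ^ (Fintype.card ι - 1) * ((∑ a, u a ^ 2 + ∑ b, v b ^ 2) / 2)) := by
          rw [sum_sum_update p fun a => u a ^ 2, sum_sum_update q fun a => v a ^ 2, ← hn, hpow]
          ring
  exact le_of_mul_le_mul_left hmain (by positivity)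

/-- The edge indicators in a product over a set of pairs of coordinates can be replaced by `1 / 2`,
one after the other. -/
lemma abs_sum_tuple_sub_le [Nonempty V]
    (hA : ∀ u v : V → ℝ, |∑ x, ∑ y, u x * v y * (adjInd G x y - 1 / 2)| ≤
      η * ((∑ x, u x ^ 2 + ∑ y, v y ^ 2) / 2))
    (hη : 0 ≤ η) (E : Finset (ι × ι)) (u v : (ι → V) → ℝ) :
    |∑ a, ∑ b, u a * v b * ((∏ e ∈ E, adjInd G (a e.1) (b e.2)) - (1 / 2) ^ E.card)| ≤
      E.card * (η * (Fintype.card V : ℝ) ^ (Fintype.card ι - 1) *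
        ((∑ a, u a ^ 2 + ∑ b, v b ^ 2) / 2)) := by
  induction E using Finset.induction_on with
  | empty => simp
  | insert e E he ih =>
    obtain ⟨p, q⟩ := e
    set B := η * (Fintype.card V : ℝ) ^ (Fintype.card ι - 1) *
        ((∑ a, u a ^ 2 + ∑ b, v b ^ 2) / 2) with hB
    have hB0 : 0 ≤ B := by positivity
    have h1 := abs_sum_tuple_edge_le hA hη E p q he u v
    rw [← hB] at h1
    have hsplit : ∑ a, ∑ b, u a * v b * ((∏ e ∈ insert (p, q) E, adjInd G (a e.1) (b e.2)) -
        (1 / 2) ^ (insert (p, q) E).card) =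
        ∑ a, ∑ b, u a * v b * ((∏ e ∈ E, adjInd G (a e.1) (b e.2)) *
          (adjInd G (a p) (b q) - 1 / 2)) +
        1 / 2 * ∑ a, ∑ b, u a * v b *
          ((∏ e ∈ E, adjInd G (a e.1) (b e.2)) - (1 / 2) ^ E.card) := by
      simp_rw [Finset.mul_sum, ← Finset.sum_add_distrib]
      refine Finset.sum_congr rfl fun a _ => Finset.sum_congr rfl fun b _ => ?_
      rw [Finset.prod_insert he, Finset.card_insert_of_notMem he, pow_succ]
      ring
    rw [hsplit, Finset.card_insert_of_notMem he]
    refine (abs_add_le _ _).trans ?_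
    rw [abs_mul, abs_of_nonneg (by norm_num : (0 : ℝ) ≤ 1 / 2)]
    push_cast
    have h2 : (0 : ℝ) ≤ E.card * B := by positivity
    linarith

/-- The same estimate for a family of tuples indexed injectively by a finite set. -/
lemma abs_sum_family_sub_le {α : Type*} [Nonempty V]
    (hA : ∀ u v : V → ℝ, |∑ x, ∑ y, u x * v y * (adjInd G x y - 1 / 2)| ≤
      η * ((∑ x, u x ^ 2 + ∑ y, v y ^ 2) / 2))
    (hη : 0 ≤ η) (S : Finset α) (f : α → ι → V) (hf : Set.InjOn f S) (d : α → ℝ) :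
    |∑ I ∈ S, ∑ J ∈ S, d I * d J * ((∏ e : ι × ι, adjInd G (f I e.1) (f J e.2)) -
        (1 / 2) ^ (Fintype.card ι ^ 2))| ≤
      Fintype.card ι ^ 2 * (η * (Fintype.card V : ℝ) ^ (Fintype.card ι - 1) *
        ∑ I ∈ S, d I ^ 2) := by
  classical
  set u : (ι → V) → ℝ := fun a => ∑ I ∈ S, if f I = a then d I else 0 with hu
  have hsum : ∀ Ψ : (ι → V) → ℝ, ∑ a, u a * Ψ a = ∑ I ∈ S, d I * Ψ (f I) := by
    intro Ψ
    simp_rw [hu, Finset.sum_mul]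
    rw [Finset.sum_comm]
    refine Finset.sum_congr rfl fun I _ => ?_
    simp [ite_mul]
  have hval : ∀ I ∈ S, u (f I) = d I := by
    intro I hI
    rw [hu]
    simp only
    rw [Finset.sum_eq_single_of_mem I hI, if_pos rfl]
    intro J hJ hne
    exact if_neg fun h => hne (hf hJ hI h)
  have hsq : ∑ a, u a ^ 2 = ∑ I ∈ S, d I ^ 2 := by
    simp_rw [sq]
    rw [hsum u]
    exact Finset.sum_congr rfl fun I hI => by rw [hval I hI]
  have key := abs_sum_tuple_sub_le hA hη (Finset.univ : Finset (ι × ι)) u u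
  have hcard : (Finset.univ : Finset (ι × ι)).card = Fintype.card ι ^ 2 := by
    rw [Finset.card_univ, Fintype.card_prod, sq]
  rw [hsq, add_self_div_two, hcard] at key
  have hform : ∑ a, ∑ b, u a * u b * ((∏ e : ι × ι, adjInd G (a e.1) (b e.2)) -
      (1 / 2) ^ (Fintype.card ι ^ 2)) = ∑ I ∈ S, ∑ J ∈ S, d I * d J *
      ((∏ e : ι × ι, adjInd G (f I e.1) (f J e.2)) - (1 / 2) ^ (Fintype.card ι ^ 2)) := by
    simp_rw [mul_assoc, ← Finset.mul_sum]
    rw [hsum]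
    exact Finset.sum_congr rfl fun I _ => by rw [hsum]
  rw [hform] at key
  exact_mod_cast key

end Bilinear

/-! ### Positivity of the moment matrix -/

section MomentMatrix

variable {V : Type*} [Fintype V] [DecidableEq V] {G : SimpleGraph V}

/-- The indicator that all pairs between `I \ K` and `J \ K` are edges. It vanishes unless
`I ∩ J ⊆ K`, since graphs have no loops. -/
noncomputable def crossInd (G : SimpleGraph V) (K I J : Finset V) : ℝ :=
  ∏ x ∈ I \ K, ∏ y ∈ J \ K, adjInd G x y

omit [Fintype V] in
lemma crossInd_eq_one {K I J : Finset V} (h : ∀ x ∈ I \ K, ∀ y ∈ J \ K, G.Adj x y) :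
    crossInd G K I J = 1 :=
  Finset.prod_eq_one fun x hx => Finset.prod_eq_one fun y hy => by
    rw [adjInd, if_pos (h x hx y hy)]

omit [Fintype V] in
lemma crossInd_eq_zero {K I J : Finset V} {x y : V} (hx : x ∈ I \ K) (hy : y ∈ J \ K)
    (h : ¬ G.Adj x y) : crossInd G K I J = 0 :=
  Finset.prod_eq_zero hx (Finset.prod_eq_zero hy (by rw [adjInd, if_neg h]))

omit [Fintype V] in
lemma crossInd_mem_Icc (K I J : Finset V) : crossInd G K I J ∈ Set.Icc (0 : ℝ) 1 :=
  ⟨Finset.prod_nonneg fun _ _ => (prod_adjInd_mem_Icc G _ _ _).1,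
    Finset.prod_le_one (fun _ _ => (prod_adjInd_mem_Icc G _ _ _).1)
      fun _ _ => (prod_adjInd_mem_Icc G _ _ _).2⟩

omit [Fintype V] in
lemma crossInd_eq_zero_of_ne {K I J : Finset V} (hI : K ⊆ I) (hJ : K ⊆ J) (hK : K ≠ I ∩ J) :
    crossInd G K I J = 0 := by
  obtain ⟨x, hx, hxK⟩ : ∃ x ∈ I ∩ J, x ∉ K := by
    by_contra! hcon
    exact hK (Finset.Subset.antisymm (Finset.subset_inter hI hJ) hcon)
  obtain ⟨h1, h2⟩ := Finset.mem_inter.1 hx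
  exact crossInd_eq_zero (Finset.mem_sdiff.2 ⟨h1, hxK⟩) (Finset.mem_sdiff.2 ⟨h2, hxK⟩) G.irrefl

/-- Between two cliques the moment matrix splits according to the intersection `K`; only
`K = I ∩ J` contributes. -/
lemma cliqueMoment_union_eq_sum (k r : ℕ) {I J : Finset V} (hIr : I.card = r) (hJr : J.card = r)
    (hI : G.IsClique (I : Set V)) (hJ : G.IsClique (J : Set V)) :
    cliqueMoment G k (2 * r) (I ∪ J) = ∑ K : Finset V, if K ⊆ I ∧ K ⊆ J then
      (k.descFactorial (2 * r - K.card) : ℝ) * (crossInd G K I J * extCount G K.card (I ∪ J))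
      else 0 := by
  rw [Finset.sum_eq_single (I ∩ J)]
  · rw [if_pos ⟨Finset.inter_subset_left, Finset.inter_subset_right⟩, cliqueMoment]
    have hc := Finset.card_union_add_card_inter I J
    have h1 : 2 * r - (I ∩ J).card = (I ∪ J).card := by omega
    have h2 : 2 * r - (I ∪ J).card = (I ∩ J).card := by omega
    rw [h1, h2]
    split_ifs with hcl
    · rw [crossInd_eq_one, one_mul]
      intro x hx y hy
      rw [Finset.mem_sdiff, Finset.mem_inter] at hx hy
      refine hcl (by simp [hx.1]) (by simp [hy.1]) ?_
      rintro rfl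
      exact hx.2 ⟨hx.1, hy.1⟩
    · obtain ⟨x, hx, y, hy, hxy⟩ : ∃ x ∈ I \ (I ∩ J), ∃ y ∈ J \ (I ∩ J), ¬ G.Adj x y := by
        by_contra! hcon
        refine hcl fun x hx y hy hne => ?_
        simp only [Finset.coe_union, Set.mem_union, Finset.mem_coe] at hx hy
        by_cases hxI : x ∈ I
        · by_cases hyI : y ∈ I
          · exact hI hxI hyI hne
          · have hyJ := hy.resolve_left hyI
            by_cases hxJ : x ∈ J
            · exact hJ hxJ hyJ hne
            · exact hcon x (by simp [hxI, hxJ]) y (by simp [hyI, hyJ])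
        · have hxJ := hx.resolve_left hxI
          by_cases hyJ : y ∈ J
          · exact hJ hxJ hyJ hne
          · exact (hcon y (by simp [hyJ, hy.resolve_right hyJ]) x (by simp [hxI, hxJ])).symm
      rw [crossInd_eq_zero hx hy hxy, zero_mul, mul_zero]
  · intro K _ hne
    split_ifs with h
    · rw [crossInd_eq_zero_of_ne h.1 h.2 hne, zero_mul, mul_zero]
    · rfl
  · simp

omit [Fintype V] in
lemma exists_enumeration [Nonempty V] (K : Finset V) (s : ℕ) :
    ∃ f : Finset V → Fin s → V, ∀ I, (I \ K).card = s →
      Function.Injective (f I) ∧ Finset.univ.image (f I) = I \ K := by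
  have h : ∀ I : Finset V, ∃ f : Fin s → V, (I \ K).card = s →
      Function.Injective f ∧ Finset.univ.image f = I \ K := by
    intro I
    by_cases hI : (I \ K).card = s
    · refine ⟨fun p => ((I \ K).equivFinOfCardEq hI).symm p, fun _ => ⟨?_, ?_⟩⟩
      · exact Subtype.val_injective.comp (Equiv.injective _)
      · ext x
        simp only [Finset.mem_image, Finset.mem_univ, true_and]
        constructor
        · rintro ⟨p, rfl⟩
          exact Finset.coe_mem _
        · intro hx
          exact ⟨(I \ K).equivFinOfCardEq hI ⟨x, hx⟩, by simp⟩
    · exact ⟨fun _ => Classical.arbitrary V, fun h => absurd h hI⟩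
  choose f hf using h
  exact ⟨f, hf⟩

/-- The part of the quadratic form in which the two index sets meet exactly in `K`, up to a sum
of squares. -/
lemma le_sum_crossInd_extCount [Nonempty V] {η : ℝ} {r : ℕ} (hη : 0 ≤ η)
    (hA : ∀ u v : V → ℝ, |∑ x, ∑ y, u x * v y * (adjInd G x y - 1 / 2)| ≤
      η * ((∑ x, u x ^ 2 + ∑ y, v y ^ 2) / 2))
    (hB : ∀ W : Finset V, W.card ≤ 2 * r →
      |((commonNbrs G W).card : ℝ) - Fintype.card V / 2 ^ W.card| ≤ η)
    (d : Finset V → ℝ) (K : Finset V) (hK : K.card ≤ r) (S : Finset (Finset V))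
    (hS : ∀ I ∈ S, K ⊆ I ∧ I.card = r) :
    extMean (Fintype.card V) K.card (2 * r - K.card) * (1 / 2) ^ ((r - K.card) ^ 2) *
        (∑ I ∈ S, d I) ^ 2 -
      2 * r ^ 2 * η * (Fintype.card V : ℝ) ^ (r - 1) * ∑ I ∈ S, d I ^ 2 ≤
      ∑ I ∈ S, ∑ J ∈ S, d I * d J * (crossInd G K I J * extCount G K.card (I ∪ J)) := by
  set n : ℝ := (Fintype.card V : ℝ) with hn
  have hn0 : 0 ≤ n := by positivity
  obtain ⟨s, hs⟩ : ∃ s, K.card + s = r := ⟨r - K.card, by omega⟩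
  set i := K.card with hi
  have hrs : r - i = s := by omega
  rw [hrs]
  have hcardS : ∀ I ∈ S, (I \ K).card = s := by
    intro I hI
    rw [Finset.card_sdiff_of_subset (hS I hI).1, (hS I hI).2]
    omega
  obtain ⟨f, hf⟩ := exists_enumeration K s
  have hinj : Set.InjOn f S := by
    intro I hI J hJ hIJ
    have h1 := (hf I (hcardS I hI)).2
    rw [hIJ, (hf J (hcardS J hJ)).2] at h1
    rw [← Finset.union_sdiff_of_subset (hS I hI).1, ← Finset.union_sdiff_of_subset (hS J hJ).1, h1]
  set Q := ∑ I ∈ S, d I ^ 2 with hQ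
  have hQ0 : 0 ≤ Q := Finset.sum_nonneg fun _ _ => sq_nonneg _
  have hScard : (S.card : ℝ) ≤ n ^ s := by
    have := Finset.card_le_card_of_injOn (t := (Finset.univ : Finset (Fin s → V))) f
      (fun _ _ => Finset.mem_coe.2 (Finset.mem_univ _)) hinj
    rw [Finset.card_univ, Fintype.card_fun, Fintype.card_fin] at this
    rw [hn]
    exact_mod_cast this
  set ν := extMean n i (2 * r - i) with hν
  have hν0 : 0 ≤ ν := extMean_nonneg hn0 _ _
  have hν1 : ν ≤ n ^ i := extMean_le hn0 _ _
  -- replacing the indicator of the cross edges by its mean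
  have hcross : |∑ I ∈ S, ∑ J ∈ S, d I * d J * (crossInd G K I J - (1 / 2) ^ (s ^ 2))| ≤
      s ^ 2 * (η * n ^ (s - 1) * Q) := by
    have key := abs_sum_family_sub_le hA hη S f hinj d
    rw [Fintype.card_fin] at key
    refine le_trans (le_of_eq ?_) key
    congr 1
    refine Finset.sum_congr rfl fun I hI => Finset.sum_congr rfl fun J hJ => ?_
    rw [crossInd, ← (hf I (hcardS I hI)).2, ← (hf J (hcardS J hJ)).2,
      Finset.prod_image fun a _ b _ h => (hf I (hcardS I hI)).1 h, Fintype.prod_prod_type]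
    congr 2
    refine Finset.prod_congr rfl fun p _ => ?_
    rw [Finset.prod_image fun a _ b _ h => (hf J (hcardS J hJ)).1 h]
  -- replacing the extension counts by their means
  have hext : |∑ I ∈ S, ∑ J ∈ S, d I * d J * (crossInd G K I J *
      (extCount G i (I ∪ J) - ν))| ≤ i * η * n ^ (i - 1) * (n ^ s * Q) := by
    have hterm : ∀ I ∈ S, ∀ J ∈ S, |d I * d J * (crossInd G K I J *
        (extCount G i (I ∪ J) - ν))| ≤ i * η * n ^ (i - 1) * (|d I| * |d J|) := by
      intro I hI J hJ
      have hnn : 0 ≤ (i : ℝ) * η * n ^ (i - 1) * (|d I| * |d J|) := by positivity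
      by_cases hKIJ : K = I ∩ J
      · have hc := Finset.card_union_add_card_inter I J
        rw [← hKIJ, (hS I hI).2, (hS J hJ).2] at hc
        have hU : (I ∪ J).card = 2 * r - i := by omega
        have h1 := abs_extCount_sub_extMean_le hη hB i (I ∪ J) (by omega)
        rw [hU] at h1
        have h2 := crossInd_mem_Icc (G := G) K I J
        rw [abs_mul, abs_mul, abs_mul, abs_of_nonneg h2.1, mul_comm (|d I| * |d J|)]
        refine mul_le_mul_of_nonneg_right ?_ (by positivity)
        exact (mul_le_of_le_one_left (abs_nonneg _) h2.2).trans h1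
      · rw [crossInd_eq_zero_of_ne (hS I hI).1 (hS J hJ).1 hKIJ]
        simpa using hnn
    calc _ ≤ ∑ I ∈ S, ∑ J ∈ S, |d I * d J * (crossInd G K I J *
          (extCount G i (I ∪ J) - ν))| :=
          (Finset.abs_sum_le_sum_abs _ _).trans
            (Finset.sum_le_sum fun _ _ => Finset.abs_sum_le_sum_abs _ _)
      _ ≤ ∑ I ∈ S, ∑ J ∈ S, i * η * n ^ (i - 1) * (|d I| * |d J|) :=
          Finset.sum_le_sum fun I hI => Finset.sum_le_sum fun J hJ => hterm I hI J hJ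
      _ = i * η * n ^ (i - 1) * (∑ I ∈ S, |d I|) ^ 2 := by
          rw [sq, Finset.sum_mul_sum]
          simp_rw [Finset.mul_sum]
      _ ≤ i * η * n ^ (i - 1) * (n ^ s * Q) := by
          refine mul_le_mul_of_nonneg_left ?_ (by positivity)
          refine sq_sum_le_card_mul_sum_sq.trans ?_
          simp_rw [sq_abs]
          exact mul_le_mul_of_nonneg_right hScard hQ0
  have hsplit : ∑ I ∈ S, ∑ J ∈ S, d I * d J * (crossInd G K I J * extCount G i (I ∪ J)) =
      ∑ I ∈ S, ∑ J ∈ S, d I * d J * (crossInd G K I J * (extCount G i (I ∪ J) - ν)) +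
      (ν * ∑ I ∈ S, ∑ J ∈ S, d I * d J * (crossInd G K I J - (1 / 2) ^ (s ^ 2)) +
      ν * (1 / 2) ^ (s ^ 2) * (∑ I ∈ S, d I) ^ 2) := by
    rw [sq (∑ I ∈ S, d I), Finset.sum_mul_sum]
    simp_rw [Finset.mul_sum, ← Finset.sum_add_distrib]
    exact Finset.sum_congr rfl fun I _ => Finset.sum_congr rfl fun J _ => by ring
  have h1 := (abs_le.1 hext).1
  have h2 : -(n ^ i * (s ^ 2 * (η * n ^ (s - 1) * Q))) ≤
      ν * ∑ I ∈ S, ∑ J ∈ S, d I * d J * (crossInd G K I J - (1 / 2) ^ (s ^ 2)) := by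
    refine (abs_le.1 ?_).1
    rw [abs_mul, abs_of_nonneg hν0]
    exact mul_le_mul hν1 hcross (abs_nonneg _) (by positivity)
  have hsr : (s : ℝ) ^ 2 ≤ r ^ 2 := by
    have : (s : ℝ) ≤ r := by exact_mod_cast (by omega : s ≤ r)
    gcongr
  have hir : (i : ℝ) ≤ r ^ 2 := by
    have : i ≤ r ^ 2 := by nlinarith
    exact_mod_cast this
  have e1 : (i : ℝ) * η * n ^ (i - 1) * (n ^ s * Q) ≤ r ^ 2 * (η * n ^ (r - 1) * Q) := by
    rcases Nat.eq_zero_or_pos i with h0 | h0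
    · rw [h0]
      simp only [Nat.cast_zero, zero_mul]
      positivity
    · have : n ^ (r - 1) = n ^ (i - 1) * n ^ s := by
        rw [← pow_add]
        congr 1
        omega
      calc (i : ℝ) * η * n ^ (i - 1) * (n ^ s * Q) = i * (η * n ^ (r - 1) * Q) := by
            rw [this]
            ring
        _ ≤ _ := mul_le_mul_of_nonneg_right hir (by positivity)
  have e2 : n ^ i * (s ^ 2 * (η * n ^ (s - 1) * Q)) ≤ r ^ 2 * (η * n ^ (r - 1) * Q) := by
    rcases Nat.eq_zero_or_pos s with h0 | h0
    · rw [h0]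
      simp only [Nat.cast_zero, ne_eq, OfNat.ofNat_ne_zero, not_false_eq_true, zero_pow, zero_mul,
        mul_zero]
      positivity
    · have : n ^ (r - 1) = n ^ i * n ^ (s - 1) := by
        rw [← pow_add]
        congr 1
        omega
      calc n ^ i * (s ^ 2 * (η * n ^ (s - 1) * Q)) = s ^ 2 * (η * n ^ (r - 1) * Q) := by
            rw [this]
            ring
        _ ≤ _ := mul_le_mul_of_nonneg_right hsr (by positivity)
  rw [hsplit]
  linarith

/-- The moment matrix is positive semidefinite as soon as its diagonal part dominates the total
fluctuation. -/
lemma moment_quadratic_form_nonneg [Nonempty V] {η : ℝ} {k r : ℕ} (hη : 0 ≤ η) (hk : 1 ≤ k)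
    (hA : ∀ u v : V → ℝ, |∑ x, ∑ y, u x * v y * (adjInd G x y - 1 / 2)| ≤
      η * ((∑ x, u x ^ 2 + ∑ y, v y ^ 2) / 2))
    (hB : ∀ W : Finset V, W.card ≤ 2 * r →
      |((commonNbrs G W).card : ℝ) - Fintype.card V / 2 ^ W.card| ≤ η)
    (hbig : 2 ^ r * ((k : ℝ) ^ (2 * r) * (2 * r ^ 2 * η * (Fintype.card V : ℝ) ^ (r - 1))) ≤
      k.descFactorial r * extMean (Fintype.card V) r r)
    (d : Finset V → ℝ) :
    0 ≤ ∑ I ∈ Finset.powersetCard r Finset.univ, ∑ J ∈ Finset.powersetCard r Finset.univ,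
      d I * d J * cliqueMoment G k (2 * r) (I ∪ J) := by
  classical
  set n : ℝ := (Fintype.card V : ℝ) with hn
  have hn0 : 0 ≤ n := by positivity
  set R : Finset (Finset V) := Finset.powersetCard r Finset.univ with hR
  set d' : Finset V → ℝ := fun I => if G.IsClique (I : Set V) then d I else 0 with hd'
  set S : Finset V → Finset (Finset V) := fun K => R.filter fun I => K ⊆ I with hS
  set err := 2 * (r : ℝ) ^ 2 * η * n ^ (r - 1) with herr
  have herr0 : 0 ≤ err := by positivity
  have hRcard : ∀ I ∈ R, I.card = r := fun I hI => (Finset.mem_powersetCard.1 hI).2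
  set T : Finset V → ℝ := fun K => ∑ I ∈ S K, ∑ J ∈ S K,
    d' I * d' J * (crossInd G K I J * extCount G K.card (I ∪ J)) with hT
  -- rows of sets that are not cliques vanish, so `d` may be replaced by `d'`
  have hsum : ∑ I ∈ R, ∑ J ∈ R, d I * d J * cliqueMoment G k (2 * r) (I ∪ J) =
      ∑ K : Finset V, (k.descFactorial (2 * r - K.card) : ℝ) * T K := by
    have h1 : ∀ I ∈ R, ∀ J ∈ R, d I * d J * cliqueMoment G k (2 * r) (I ∪ J) =
        ∑ K : Finset V, if K ⊆ I then (if K ⊆ J then (k.descFactorial (2 * r - K.card) : ℝ) *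
          (d' I * d' J * (crossInd G K I J * extCount G K.card (I ∪ J))) else 0) else 0 := by
      intro I hI J hJ
      by_cases hc : G.IsClique (I : Set V) ∧ G.IsClique (J : Set V)
      · rw [cliqueMoment_union_eq_sum k r (hRcard I hI) (hRcard J hJ) hc.1 hc.2, Finset.mul_sum]
        refine Finset.sum_congr rfl fun K _ => ?_
        simp only [hd', if_pos hc.1, if_pos hc.2, ite_and]
        split_ifs <;> ring
      · have hm : cliqueMoment G k (2 * r) (I ∪ J) = 0 := by
          rw [cliqueMoment, if_neg]
          intro h
          exact hc ⟨h.subset (by simp), h.subset (by simp)⟩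
        have hz : d' I * d' J = 0 := by
          rcases not_and_or.1 hc with h | h
          · simp only [hd', if_neg h, zero_mul]
          · simp only [hd', if_neg h, mul_zero]
        rw [hm, mul_zero, Finset.sum_eq_zero]
        intro K _
        rw [hz]
        simp
    rw [Finset.sum_congr rfl fun I hI => Finset.sum_congr rfl fun J hJ => h1 I hI J hJ]
    rw [Finset.sum_congr rfl fun I _ => Finset.sum_comm, Finset.sum_comm]
    refine Finset.sum_congr rfl fun K _ => ?_
    simp only [hT, hS, Finset.mul_sum, Finset.sum_filter]
    refine Finset.sum_congr rfl fun I _ => ?_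
    split_ifs with h
    · rw [Finset.mul_sum]
      exact Finset.sum_congr rfl fun J _ => by split_ifs <;> simp
    · simp
  have hbound : ∀ K : Finset V, (if K ∈ R then
      (k.descFactorial r * extMean n r r) * d' K ^ 2 else 0) -
      (k : ℝ) ^ (2 * r) * err * ∑ I ∈ S K, d' I ^ 2 ≤
      (k.descFactorial (2 * r - K.card) : ℝ) * T K := by
    intro K
    have hsq0 : 0 ≤ ∑ I ∈ S K, d' I ^ 2 := Finset.sum_nonneg fun _ _ => sq_nonneg _
    by_cases hK : K.card ≤ r
    · have key := le_sum_crossInd_extCount hη hA hB d' K hK (S K) fun I hI =>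
        ⟨(Finset.mem_filter.1 hI).2, hRcard I (Finset.mem_filter.1 hI).1⟩
      rw [← hn, ← herr] at key
      have hγ : (k.descFactorial (2 * r - K.card) : ℝ) ≤ (k : ℝ) ^ (2 * r) := by
        have h1 : k.descFactorial (2 * r - K.card) ≤ k ^ (2 * r) :=
          (Nat.descFactorial_le_pow _ _).trans (Nat.pow_le_pow_right hk (Nat.sub_le _ _))
        exact_mod_cast h1
      have hγ0 : (0 : ℝ) ≤ k.descFactorial (2 * r - K.card) := by positivity
      have h2 := mul_le_mul_of_nonneg_left key hγ0
      refine le_trans ?_ h2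
      rw [mul_sub]
      refine sub_le_sub ?_ ?_
      · split_ifs with hKR
        · have hKr := hRcard K hKR
          have hSK : S K = {K} := by
            ext I
            simp only [hS, Finset.mem_filter, Finset.mem_singleton]
            constructor
            · rintro ⟨hI, hsub⟩
              exact (Finset.eq_of_subset_of_card_le hsub (by rw [hRcard I hI, hKr])).symm
            · rintro rfl
              exact ⟨hKR, subset_rfl⟩
          have h2r : 2 * r - r = r := by omega
          rw [hSK, hKr, h2r]
          simp [mul_assoc]
        · have := extMean_nonneg hn0 K.card (2 * r - K.card)
          positivity
      · rw [← mul_assoc]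
        gcongr
    · have hSK : S K = ∅ := by
        refine Finset.filter_eq_empty_iff.2 fun I hI hsub => hK ?_
        rw [← hRcard I hI]
        exact Finset.card_le_card hsub
      have hKR : K ∉ R := fun h => hK (hRcard K h).le
      simp [hT, hSK, hKR]
  have hdouble : ∑ K : Finset V, ∑ I ∈ S K, d' I ^ 2 = 2 ^ r * ∑ I ∈ R, d' I ^ 2 := by
    simp only [hS, Finset.sum_filter]
    rw [Finset.sum_comm, Finset.mul_sum]
    refine Finset.sum_congr rfl fun I hI => ?_
    rw [← Finset.sum_filter, Finset.sum_const, nsmul_eq_mul]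
    congr 1
    have : (Finset.univ.filter fun K => K ⊆ I) = I.powerset := by
      ext K
      simp
    rw [this, Finset.card_powerset, hRcard I hI]
    norm_num
  rw [hsum]
  refine le_trans ?_ (Finset.sum_le_sum fun K _ => hbound K)
  rw [Finset.sum_sub_distrib, ← Finset.mul_sum, hdouble, Finset.sum_ite_mem, Finset.univ_inter,
    ← Finset.mul_sum]
  have h0 : 0 ≤ ∑ I ∈ R, d' I ^ 2 := Finset.sum_nonneg fun _ _ => sq_nonneg _
  have h3 := mul_le_mul_of_nonneg_right hbig h0
  linarith

end MomentMatrix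

/-! ### The uniform random graph and edge flips -/

/-- Symmetrization: if the bijection `φ j` negates `X j` and preserves all the other `X i`, then
under the uniform measure `∑ X j` has the exponential moment of a Rademacher sum. -/
lemma sum_exp_le_of_flips {Ω α : Type*} [Fintype Ω] (S : Finset α) (X : α → Ω → ℝ) (b : α → ℝ)
    (φ : α → Equiv.Perm Ω) (hneg : ∀ j ∈ S, ∀ ω, X j (φ j ω) = -X j ω)
    (hfix : ∀ j ∈ S, ∀ i ∈ S, i ≠ j → ∀ ω, X i (φ j ω) = X i ω)
    (hb : ∀ j ∈ S, ∀ ω, X j ω ^ 2 ≤ b j) :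
    ∑ ω, Real.exp (∑ j ∈ S, X j ω) ≤ Fintype.card Ω * Real.exp ((∑ j ∈ S, b j) / 2) := by
  classical
  induction S using Finset.induction_on with
  | empty => simp
  | insert j S hj ih =>
    have ih' := ih (fun i hi => hneg i (Finset.mem_insert_of_mem hi))
      (fun i hi l hl => hfix i (Finset.mem_insert_of_mem hi) l (Finset.mem_insert_of_mem hl))
      (fun i hi => hb i (Finset.mem_insert_of_mem hi))
    set Y : Ω → ℝ := fun ω => Real.exp (∑ i ∈ S, X i ω) with hY
    have hjS := Finset.mem_insert_self j S
    have hYfix : ∀ ω, Y (φ j ω) = Y ω := by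
      intro ω
      simp only [hY]
      congr 1
      refine Finset.sum_congr rfl fun i hi => hfix j hjS i (Finset.mem_insert_of_mem hi) ?_ ω
      rintro rfl
      exact hj hi
    have hflip : ∑ ω, Real.exp (X j ω) * Y ω = ∑ ω, Real.exp (-X j ω) * Y ω := by
      rw [← Equiv.sum_comp (φ j)]
      exact Finset.sum_congr rfl fun ω _ => by rw [hneg j hjS, hYfix]
    have hcosh : ∑ ω, Real.exp (X j ω) * Y ω = ∑ ω, Real.cosh (X j ω) * Y ω := by
      have h2 : ∑ ω, Real.cosh (X j ω) * Y ω =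
          (∑ ω, Real.exp (X j ω) * Y ω + ∑ ω, Real.exp (-X j ω) * Y ω) / 2 := by
        rw [← Finset.sum_add_distrib, Finset.sum_div]
        exact Finset.sum_congr rfl fun ω _ => by rw [Real.cosh_eq]; ring
      rw [h2, ← hflip]
      ring
    calc ∑ ω, Real.exp (∑ i ∈ insert j S, X i ω) = ∑ ω, Real.exp (X j ω) * Y ω :=
          Finset.sum_congr rfl fun ω _ => by rw [Finset.sum_insert hj, Real.exp_add]
      _ = ∑ ω, Real.cosh (X j ω) * Y ω := hcosh
      _ ≤ ∑ ω, Real.exp (b j / 2) * Y ω := by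
          refine Finset.sum_le_sum fun ω _ => mul_le_mul_of_nonneg_right ?_ (Real.exp_pos _).le
          refine (Real.cosh_le_exp_half_sq _).trans (Real.exp_le_exp.2 ?_)
          have := hb j hjS ω
          linarith
      _ = Real.exp (b j / 2) * ∑ ω, Y ω := by rw [Finset.mul_sum]
      _ ≤ Real.exp (b j / 2) * (Fintype.card Ω * Real.exp ((∑ i ∈ S, b i) / 2)) :=
          mul_le_mul_of_nonneg_left ih' (Real.exp_pos _).le
      _ = Fintype.card Ω * Real.exp ((∑ i ∈ insert j S, b i) / 2) := by
          rw [Finset.sum_insert hj, add_div, Real.exp_add]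
          ring

section Uniform

open MeasureTheory

variable {V : Type*} [Fintype V] [DecidableEq V]

/-- `G(V, 1/2)` is the uniform measure on graphs, so Markov's inequality for the exponential
moment can be checked by summing over graphs. -/
lemma binomialRandom_half_real_le (X : SimpleGraph V → ℝ) (v t : ℝ)
    (h : ∑ G : SimpleGraph V, Real.exp (X G) ≤ Fintype.card (SimpleGraph V) * Real.exp v) :
    (SimpleGraph.binomialRandom V edgeProbHalf).real {G | t ≤ X G} ≤ Real.exp (v - t) := by
  classical
  set μ := SimpleGraph.binomialRandom V edgeProbHalf with hμ
  set N := Fintype.card (SimpleGraph V) with hN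
  obtain ⟨c, hc⟩ : ∃ c : ℝ, ∀ G : SimpleGraph V, μ.real {G} = c := by
    refine ⟨(1 / 2) ^ ((Nat.card V).choose 2), fun G => ?_⟩
    have hhalf : (unitInterval.symm edgeProbHalf) = edgeProbHalf := by
      apply Subtype.ext
      rw [unitInterval.coe_symm_eq]
      norm_num [edgeProbHalf]
    have hle : G.edgeSet.ncard ≤ (Nat.card V).choose 2 := by
      rw [← SimpleGraph.coe_edgeFinset, Set.ncard_coe_finset, Nat.card_eq_fintype_card]
      exact G.card_edgeFinset_le_card_choose_two
    rw [measureReal_def, hμ, SimpleGraph.binomialRandom_singleton, hhalf, ← pow_add,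
      Nat.add_sub_cancel' hle]
    simp [edgeProbHalf]
  have hmeas : MeasurableSingletonClass (SimpleGraph V) := by
    refine ⟨fun G => ?_⟩
    have : ({G} : Set (SimpleGraph V)) = SimpleGraph.edgeSet ⁻¹' {G.edgeSet} := by
      ext H
      simp
    rw [this]
    exact SimpleGraph.measurable_edgeSet (measurableSet_singleton _)
  have hsum : ∀ S : Finset (SimpleGraph V), μ.real (S : Set (SimpleGraph V)) = S.card * c := by
    intro S
    rw [← sum_measureReal_singleton, Finset.sum_congr rfl fun G _ => hc G]
    simp
  have hNc : (N : ℝ) * c = 1 := by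
    have := hsum Finset.univ
    rw [Finset.coe_univ, Finset.card_univ, probReal_univ] at this
    exact this.symm
  have hc0 : 0 ≤ c := by
    rw [← hc ⊥]
    exact measureReal_nonneg
  set B : Finset (SimpleGraph V) := Finset.univ.filter fun G => t ≤ X G with hB
  have hBset : {G | t ≤ X G} = (B : Set (SimpleGraph V)) := by
    ext G
    simp [hB]
  have hmarkov : B.card * Real.exp t ≤ N * Real.exp v := by
    refine le_trans ?_ h
    rw [← nsmul_eq_mul, ← Finset.sum_const]
    refine (Finset.sum_le_sum (s := B) (g := fun G => Real.exp (X G)) fun G hG =>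
      Real.exp_le_exp.2 (Finset.mem_filter.1 hG).2).trans ?_
    exact Finset.sum_le_sum_of_subset_of_nonneg (Finset.subset_univ _)
      fun _ _ _ => (Real.exp_pos _).le
  rw [hBset, hsum, Real.exp_sub, le_div_iff₀ (Real.exp_pos t)]
  calc (B.card : ℝ) * c * Real.exp t = B.card * Real.exp t * c := by ring
    _ ≤ N * Real.exp v * c := mul_le_mul_of_nonneg_right hmarkov hc0
    _ = (N * c) * Real.exp v := by ring
    _ = Real.exp v := by rw [hNc, one_mul]

/-- Toggling the edge between `a` and `b`. -/
noncomputable def flipEdge (a b : V) : Equiv.Perm (SimpleGraph V) :=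
  Function.Involutive.toPerm (fun G => symmDiff G (SimpleGraph.edge a b))
    fun G => symmDiff_symmDiff_cancel_right _ G

omit [Fintype V] [DecidableEq V] in
lemma flipEdge_adj (a b : V) (G : SimpleGraph V) (x y : V) :
    (flipEdge a b G).Adj x y ↔
      (G.Adj x y ∧ ¬ (SimpleGraph.edge a b).Adj x y) ∨
        ((SimpleGraph.edge a b).Adj x y ∧ ¬ G.Adj x y) := by
  change (symmDiff G (SimpleGraph.edge a b)).Adj x y ↔ _
  rw [symmDiff_def, SimpleGraph.sup_adj, SimpleGraph.sdiff_adj, SimpleGraph.sdiff_adj]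

omit [Fintype V] [DecidableEq V] in
lemma flipEdge_adj_self {a b : V} (hab : a ≠ b) (G : SimpleGraph V) :
    (flipEdge a b G).Adj a b ↔ ¬ G.Adj a b := by
  rw [flipEdge_adj]
  simp [SimpleGraph.edge_adj, hab]

omit [Fintype V] [DecidableEq V] in
lemma flipEdge_adj_of_ne {a b x y : V} (h : ¬ (a = x ∧ b = y)) (h' : ¬ (a = y ∧ b = x))
    (G : SimpleGraph V) : (flipEdge a b G).Adj x y ↔ G.Adj x y := by
  rw [flipEdge_adj]
  have : ¬ (SimpleGraph.edge a b).Adj x y := by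
    rw [SimpleGraph.edge_adj]
    tauto
  tauto

omit [Fintype V] [DecidableEq V] in
lemma adjInd_flipEdge_self {a b : V} (hab : a ≠ b) (G : SimpleGraph V) :
    adjInd (flipEdge a b G) a b = 1 - adjInd G a b := by
  have h := flipEdge_adj_self hab G
  unfold adjInd
  by_cases hG : G.Adj a b <;> simp [h, hG]

omit [Fintype V] [DecidableEq V] in
lemma adjInd_flipEdge_of_ne {a b x y : V} (h : ¬ (a = x ∧ b = y)) (h' : ¬ (a = y ∧ b = x))
    (G : SimpleGraph V) : adjInd (flipEdge a b G) x y = adjInd G x y := by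
  have hiff := flipEdge_adj_of_ne h h' G
  unfold adjInd
  by_cases hG : G.Adj x y <;> simp [hiff, hG]

omit [Fintype V] [DecidableEq V] in
lemma sq_two_mul_adjInd_sub_one (G : SimpleGraph V) (x y : V) : (2 * adjInd G x y - 1) ^ 2 = 1 := by
  unfold adjInd
  split_ifs <;> norm_num

end Uniform

/-! ### Common neighbourhoods in the random graph -/

section Codegree

open MeasureTheory

variable {V : Type*} [Fintype V] [DecidableEq V]

/-- If adding a vertex always halves the common neighbourhood up to an error `κ / 2`, the errors
form a geometric series. -/
lemma abs_card_commonNbrs_sub_le {G : SimpleGraph V} {κ : ℝ} (D : ℕ) (hκ : 0 ≤ κ)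
    (h : ∀ (U : Finset V) (w : V), U.card < D → w ∉ U →
      |2 * ((commonNbrs G (insert w U)).card : ℝ) - (commonNbrs G U).card| ≤ κ)
    (W : Finset V) (hW : W.card ≤ D) :
    |((commonNbrs G W).card : ℝ) - Fintype.card V / 2 ^ W.card| ≤ κ := by
  induction W using Finset.induction_on with
  | empty => simpa [commonNbrs] using hκ
  | insert w U hw ih =>
    rw [Finset.card_insert_of_notMem hw] at hW ⊢
    have h1 := abs_le.1 (ih (by omega))
    have h2 := abs_le.1 (h U w (by omega) hw)
    have h3 : (Fintype.card V : ℝ) / 2 ^ (U.card + 1) = Fintype.card V / 2 ^ U.card / 2 := by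
      rw [pow_succ, div_div]
    rw [h3, abs_le]
    constructor <;> linarith [h1.1, h1.2, h2.1, h2.2]

lemma sum_exp_codegree_le (U : Finset V) (w : V) (hw : w ∉ U) (s : ℝ) :
    ∑ G : SimpleGraph V, Real.exp (∑ t ∈ Finset.univ.erase w,
        if t ∈ commonNbrs G U then s * (2 * adjInd G w t - 1) else 0) ≤
      Fintype.card (SimpleGraph V) * Real.exp (Fintype.card V * s ^ 2 / 2) := by
  have hmem : ∀ a t : V, a ≠ w → t ≠ w → ∀ G : SimpleGraph V,
      t ∈ commonNbrs (flipEdge w a G) U ↔ t ∈ commonNbrs G U := by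
    intro a t ha ht G
    rw [mem_commonNbrs, mem_commonNbrs]
    refine forall₂_congr fun u hu => flipEdge_adj_of_ne ?_ ?_ G
    · rintro ⟨rfl, -⟩
      exact hw hu
    · rintro ⟨rfl, -⟩
      exact ht rfl
  refine (sum_exp_le_of_flips (Finset.univ.erase w)
    (fun t G => if t ∈ commonNbrs G U then s * (2 * adjInd G w t - 1) else 0)
    (fun _ => s ^ 2) (fun t => flipEdge w t) ?_ ?_ ?_).trans ?_
  · intro t ht G
    have htw : t ≠ w := Finset.ne_of_mem_erase ht
    simp only [hmem t t htw htw, adjInd_flipEdge_self htw.symm]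
    split_ifs <;> ring
  · intro a ha t ht hta G
    have haw : a ≠ w := Finset.ne_of_mem_erase ha
    have htw : t ≠ w := Finset.ne_of_mem_erase ht
    simp only [hmem a t haw htw]
    rw [adjInd_flipEdge_of_ne (fun h => hta h.2.symm) (fun h => haw h.2)]
  · intro t _ G
    split_ifs
    · rw [mul_pow, sq_two_mul_adjInd_sub_one, mul_one]
    · simpa using sq_nonneg s
  · refine mul_le_mul_of_nonneg_left (Real.exp_le_exp.2 ?_) (by positivity)
    rw [Finset.sum_const, nsmul_eq_mul]
    have : ((Finset.univ.erase w).card : ℝ) ≤ Fintype.card V := by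
      exact_mod_cast Finset.card_le_univ _
    gcongr

lemma sum_codegree_eq {G : SimpleGraph V} (U : Finset V) (w : V) (s : ℝ) :
    ∑ t ∈ Finset.univ.erase w, (if t ∈ commonNbrs G U then s * (2 * adjInd G w t - 1) else 0) =
      s * (2 * (commonNbrs G (insert w U)).card - (commonNbrs G U).card +
        if w ∈ commonNbrs G U then 1 else 0) := by
  classical
  have h1 : (commonNbrs G (insert w U)) = (commonNbrs G U).filter fun t => G.Adj w t := by
    ext t
    rw [Finset.mem_filter, mem_commonNbrs, mem_commonNbrs, Finset.forall_mem_insert, and_comm]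
  have h2 : ((commonNbrs G (insert w U)).card : ℝ) = ∑ t ∈ commonNbrs G U, adjInd G w t := by
    rw [h1, Finset.card_filter]
    push_cast
    refine Finset.sum_congr rfl fun t _ => ?_
    unfold adjInd
    split_ifs <;> rfl
  have h3 : ∑ t, (if t ∈ commonNbrs G U then s * (2 * adjInd G w t - 1) else 0) =
      s * (2 * (commonNbrs G (insert w U)).card - (commonNbrs G U).card) := by
    rw [← Finset.sum_filter, Finset.filter_mem_eq_inter, Finset.univ_inter, h2, ← Finset.mul_sum,
      Finset.sum_sub_distrib, ← Finset.mul_sum]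
    simp
  have h4 := Finset.sum_erase_add Finset.univ
    (fun t => if t ∈ commonNbrs G U then s * (2 * adjInd G w t - 1) else 0) (Finset.mem_univ w)
  have h5 : adjInd G w w = 0 := by simp [adjInd]
  rw [h3] at h4
  simp only [h5] at h4
  split_ifs at h4 ⊢ <;> linarith

lemma codegree_tail (hn : 0 < Fintype.card V) (U : Finset V) (w : V) (hw : w ∉ U) {lam : ℝ}
    (hlam : 0 < lam) :
    (SimpleGraph.binomialRandom V edgeProbHalf).real
        {G | lam + 1 < |2 * ((commonNbrs G (insert w U)).card : ℝ) - (commonNbrs G U).card|} ≤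
      2 * Real.exp (-(lam ^ 2 / (2 * Fintype.card V))) := by
  set n : ℝ := (Fintype.card V : ℝ) with hn'
  have hn0 : 0 < n := by
    rw [hn']
    exact_mod_cast hn
  set X : ℝ → SimpleGraph V → ℝ := fun s G => ∑ t ∈ Finset.univ.erase w,
    if t ∈ commonNbrs G U then s * (2 * adjInd G w t - 1) else 0 with hX
  have htail : ∀ s : ℝ, s ^ 2 = (lam / n) ^ 2 →
      (SimpleGraph.binomialRandom V edgeProbHalf).real {G | lam ^ 2 / n ≤ X s G} ≤
        Real.exp (-(lam ^ 2 / (2 * n))) := by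
    intro s hs
    refine (binomialRandom_half_real_le (X s) _ (lam ^ 2 / n)
      (sum_exp_codegree_le U w hw s)).trans_eq ?_
    rw [hs, ← hn']
    congr 1
    field_simp
    ring
  have hsub : {G : SimpleGraph V | lam + 1 <
      |2 * ((commonNbrs G (insert w U)).card : ℝ) - (commonNbrs G U).card|} ⊆
      {G | lam ^ 2 / n ≤ X (lam / n) G} ∪ {G | lam ^ 2 / n ≤ X (-(lam / n)) G} := by
    intro G hG
    simp only [Set.mem_ofPred_eq, Set.mem_union] at hG ⊢
    simp only [hX, sum_codegree_eq]
    have hdiv : lam ^ 2 / n = lam / n * lam := by ring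
    have hpos : 0 ≤ lam / n := by positivity
    have h01 : (0 : ℝ) ≤ (if w ∈ commonNbrs G U then 1 else 0) ∧
        (if w ∈ commonNbrs G U then (1 : ℝ) else 0) ≤ 1 := by
      split_ifs <;> norm_num
    rw [hdiv]
    rcases lt_abs.1 hG with h | h
    · left
      exact mul_le_mul_of_nonneg_left (by linarith [h01.1]) hpos
    · right
      rw [neg_mul_comm]
      exact mul_le_mul_of_nonneg_left (by linarith [h01.2]) hpos
  calc _ ≤ _ := measureReal_mono hsub
    _ ≤ _ := measureReal_union_le _ _
    _ ≤ _ := by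
      have h1 := htail (lam / n) rfl
      have h2 := htail (-(lam / n)) (by ring)
      linarith

end Codegree

/-! ### The spectral norm of the random sign matrix -/

/-- The `±1` adjacency matrix of a graph, with zero diagonal. -/
noncomputable def signMatrix {n : ℕ} (G : SimpleGraph (Fin n)) : Matrix (Fin n) (Fin n) ℝ :=
  fun x y => if x = y then 0 else 2 * adjInd G x y - 1

section SignMatrix

open MeasureTheory

variable {n : ℕ}

lemma sum_signMatrix_eq (G : SimpleGraph (Fin n)) (z z' : Fin n → ℝ) :
    ∑ x, ∑ y, z x * z' y * signMatrix G x y =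
      ∑ e ∈ (Finset.univ : Finset (Fin n × Fin n)).filter (fun e => e.1 < e.2),
        (z e.1 * z' e.2 + z e.2 * z' e.1) * (2 * adjInd G e.1 e.2 - 1) := by
  have h1 : ∀ x y, z x * z' y * signMatrix G x y =
      (if x < y then z x * z' y * (2 * adjInd G x y - 1) else 0) +
      (if y < x then z x * z' y * (2 * adjInd G y x - 1) else 0) := by
    intro x y
    have hsymm : adjInd G x y = adjInd G y x := by
      have hiff := G.adj_comm x y
      unfold adjInd
      by_cases hG : G.Adj y x <;> simp [hiff, hG]
    rcases lt_trichotomy x y with h | h | h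
    · simp [signMatrix, h, h.ne, h.not_gt]
    · simp [signMatrix, h]
    · simp [signMatrix, h, h.ne', h.not_gt, hsymm]
  simp_rw [h1, Finset.sum_add_distrib]
  rw [Finset.sum_comm (f := fun x y => if y < x then z x * z' y * (2 * adjInd G y x - 1) else 0),
    ← Finset.sum_add_distrib, Finset.sum_filter, Fintype.sum_prod_type]
  refine Finset.sum_congr rfl fun x _ => ?_
  rw [← Finset.sum_add_distrib]
  refine Finset.sum_congr rfl fun y _ => ?_
  split_ifs <;> ring

lemma sum_exp_signMatrix_le (z z' : Fin n → ℝ) (s : ℝ) :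
    ∑ G : SimpleGraph (Fin n), Real.exp (s * ∑ x, ∑ y, z x * z' y * signMatrix G x y) ≤
      Fintype.card (SimpleGraph (Fin n)) *
        Real.exp (s ^ 2 * ((∑ x, z x ^ 2) * ∑ y, z' y ^ 2)) := by
  set P := (Finset.univ : Finset (Fin n × Fin n)).filter (fun e => e.1 < e.2) with hP
  set c : Fin n × Fin n → ℝ := fun e => z e.1 * z' e.2 + z e.2 * z' e.1 with hc
  have key := sum_exp_le_of_flips P (fun e (G : SimpleGraph (Fin n)) =>
      s * (c e * (2 * adjInd G e.1 e.2 - 1))) (fun e => s ^ 2 * c e ^ 2)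
      (fun e => flipEdge e.1 e.2) ?_ ?_ ?_
  · have hform : ∀ G : SimpleGraph (Fin n), s * ∑ x, ∑ y, z x * z' y * signMatrix G x y =
        ∑ e ∈ P, s * (c e * (2 * adjInd G e.1 e.2 - 1)) := fun G => by
      rw [sum_signMatrix_eq, Finset.mul_sum]
    simp_rw [hform]
    refine key.trans (mul_le_mul_of_nonneg_left (Real.exp_le_exp.2 ?_) (by positivity))
    rw [← Finset.mul_sum, mul_div_assoc]
    refine mul_le_mul_of_nonneg_left ?_ (sq_nonneg s)
    have h1 : ∑ e ∈ P, c e ^ 2 ≤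
        ∑ e ∈ P, 2 * (z e.1 ^ 2 * z' e.2 ^ 2 + z e.2 ^ 2 * z' e.1 ^ 2) := by
      refine Finset.sum_le_sum fun e _ => ?_
      simp only [hc]
      nlinarith [sq_nonneg (z e.1 * z' e.2 - z e.2 * z' e.1)]
    have h2 : ∑ e ∈ P, (z e.1 ^ 2 * z' e.2 ^ 2 + z e.2 ^ 2 * z' e.1 ^ 2) ≤
        (∑ x, z x ^ 2) * ∑ y, z' y ^ 2 := by
      have h3 : (∑ x, z x ^ 2) * ∑ y, z' y ^ 2 = ∑ x, ∑ y,
          ((if x < y then z x ^ 2 * z' y ^ 2 else 0) +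
            (if y < x then z x ^ 2 * z' y ^ 2 else 0) +
            (if x = y then z x ^ 2 * z' y ^ 2 else 0)) := by
        rw [Finset.sum_mul_sum]
        refine Finset.sum_congr rfl fun x _ => Finset.sum_congr rfl fun y _ => ?_
        rcases lt_trichotomy x y with h | h | h
        · simp [h, h.ne, h.not_gt]
        · simp [h]
        · simp [h, h.ne', h.not_gt]
      have h4 : ∑ e ∈ P, (z e.1 ^ 2 * z' e.2 ^ 2 + z e.2 ^ 2 * z' e.1 ^ 2) =
          ∑ x, ∑ y, ((if x < y then z x ^ 2 * z' y ^ 2 else 0) +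
            (if y < x then z x ^ 2 * z' y ^ 2 else 0)) := by
        simp_rw [Finset.sum_add_distrib]
        rw [Finset.sum_comm (f := fun x y => if y < x then z x ^ 2 * z' y ^ 2 else 0), hP,
          Finset.sum_filter, Finset.sum_filter, Fintype.sum_prod_type, Fintype.sum_prod_type]
      rw [h3, h4]
      refine Finset.sum_le_sum fun x _ => Finset.sum_le_sum fun y _ =>
        le_add_of_nonneg_right ?_
      split_ifs <;> positivity
    rw [← Finset.mul_sum] at h1
    linarith
  · intro e he G
    rw [adjInd_flipEdge_self (Finset.mem_filter.1 he).2.ne]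
    ring
  · intro e he f hf hne G
    have h1 := (Finset.mem_filter.1 he).2
    have h2 := (Finset.mem_filter.1 hf).2
    rw [adjInd_flipEdge_of_ne]
    · exact fun h => hne (Prod.ext h.1.symm h.2.symm)
    · rintro ⟨h3, h4⟩
      rw [h3, h4] at h1
      exact absurd h1 h2.not_gt
  · intro e _ G
    rw [mul_pow, mul_pow, sq_two_mul_adjInd_sub_one, mul_one]

lemma signMatrix_tail (z z' : Fin n → ℝ) (hz : ∑ x, z x ^ 2 ≤ 2) (hz' : ∑ x, z' x ^ 2 ≤ 2)
    {t : ℝ} (ht : 0 ≤ t) :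
    (SimpleGraph.binomialRandom (Fin n) edgeProbHalf).real
        {G | t ≤ ∑ x, ∑ y, z x * z' y * signMatrix G x y} ≤ Real.exp (-(t ^ 2 / 16)) := by
  have hsub : {G : SimpleGraph (Fin n) | t ≤ ∑ x, ∑ y, z x * z' y * signMatrix G x y} ⊆
      {G | t / 8 * t ≤ t / 8 * ∑ x, ∑ y, z x * z' y * signMatrix G x y} :=
    fun G (hG : t ≤ _) => mul_le_mul_of_nonneg_left hG (div_nonneg ht (by norm_num))
  -- `t / 8` minimizes `4 s ^ 2 - s t`
  refine (measureReal_mono hsub).trans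
    ((binomialRandom_half_real_le _ _ _ (sum_exp_signMatrix_le z z' (t / 8))).trans ?_)
  refine Real.exp_le_exp.2 ?_
  have h1 : (∑ x, z x ^ 2) * ∑ x, z' x ^ 2 ≤ 2 * 2 :=
    mul_le_mul hz hz' (Finset.sum_nonneg fun _ _ => sq_nonneg _) zero_le_two
  nlinarith [mul_le_mul_of_nonneg_left h1 (sq_nonneg (t / 8))]

/-- The grid points of mesh `1 / (2n)` in the ball of squared radius `2`, by their integer
coordinates. -/
noncomputable def gridNet (n : ℕ) : Finset (Fin n → ℤ) :=
  (Fintype.piFinset fun _ => Finset.Icc (-(2 * n : ℤ)) (2 * n)).filter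
    fun m => ∑ x, ((m x : ℝ) / (2 * n)) ^ 2 ≤ 2

lemma card_gridNet_le (n : ℕ) : (gridNet n).card ≤ (4 * n + 1) ^ n := by
  refine (Finset.card_filter_le _ _).trans ?_
  rw [Fintype.card_piFinset_const, Int.card_Icc]
  refine le_of_eq ?_
  congr 1
  omega

lemma exists_mem_gridNet (hn : 0 < n) (x : EuclideanSpace ℝ (Fin n)) (hx : ‖x‖ ≤ 1) :
    ∃ m ∈ gridNet n, ‖x - WithLp.toLp 2 fun i => (m i : ℝ) / (2 * n)‖ ≤ 1 / 4 := by
  have hn1 : (1 : ℝ) ≤ n := by exact_mod_cast hn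
  set m : Fin n → ℤ := fun i => round (2 * n * x i) with hm
  set z : EuclideanSpace ℝ (Fin n) := WithLp.toLp 2 fun i => (m i : ℝ) / (2 * n) with hz
  have hcoord : ∀ i, |x i| ≤ 1 := fun i => (PiLp.norm_apply_le x i).trans hx
  have hdist : ‖x - z‖ ≤ 1 / 4 := by
    have hi : ∀ i, ‖(x - z) i‖ ^ 2 ≤ (1 / (4 * n)) ^ 2 := by
      intro i
      refine pow_le_pow_left₀ (norm_nonneg _) ?_ 2
      have h1 := abs_sub_round (2 * n * x i)
      have h2 : (x - z) i = (2 * n * x i - m i) / (2 * n) := by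
        simp only [hz, PiLp.sub_apply]
        field_simp
      rw [h2, Real.norm_eq_abs, abs_div, abs_of_pos (by positivity : (0 : ℝ) < 2 * n),
        div_le_iff₀ (by positivity)]
      refine h1.trans (le_of_eq ?_)
      field_simp
      norm_num
    have hsq : ‖x - z‖ ^ 2 ≤ (1 / 4) ^ 2 := by
      rw [EuclideanSpace.norm_sq_eq]
      refine (Finset.sum_le_sum fun i _ => hi i).trans ?_
      rw [Finset.sum_const, Finset.card_univ, Fintype.card_fin, nsmul_eq_mul]
      have h3 : (n : ℝ) * (1 / (4 * n)) ^ 2 = (1 / 4) ^ 2 / n := by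
        field_simp
      rw [h3]
      exact div_le_self (by norm_num) hn1
    exact le_of_sq_le_sq hsq (by norm_num)
  refine ⟨m, ?_, hdist⟩
  rw [gridNet, Finset.mem_filter, Fintype.mem_piFinset]
  constructor
  · intro i
    have h1 := abs_le.1 (hcoord i)
    have h2 := abs_le.1 (abs_sub_round (2 * n * x i))
    have h3 : ((-(2 * n : ℤ) - 1 : ℤ) : ℝ) < m i := by
      push_cast
      nlinarith [h1.1, h2.2]
    have h4 : (m i : ℝ) < ((2 * n + 1 : ℤ) : ℝ) := by
      push_cast
      nlinarith [h1.2, h2.1]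
    rw [Finset.mem_Icc]
    have h5 := Int.cast_lt.1 h3
    have h6 := Int.cast_lt.1 h4
    omega
  · have hnorm : ‖z‖ ≤ 5 / 4 := by
      have h1 := norm_sub_norm_le z x
      rw [norm_sub_rev] at h1
      linarith
    have h2 : ∑ i, ((m i : ℝ) / (2 * n)) ^ 2 = ‖z‖ ^ 2 := by
      rw [EuclideanSpace.norm_sq_eq]
      simp only [hz, Real.norm_eq_abs, sq_abs]
    rw [h2]
    nlinarith [norm_nonneg z]

/-- A bound for the bilinear form on the grid gives a bound for the operator norm. -/
lemma norm_toEuclideanCLM_le_of_gridNet (hn : 0 < n) (A : Matrix (Fin n) (Fin n) ℝ) {t : ℝ}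
    (h : ∀ m ∈ gridNet n, ∀ m' ∈ gridNet n,
      ∑ x, ∑ y, ((m x : ℝ) / (2 * n)) * ((m' y : ℝ) / (2 * n)) * A x y ≤ t) :
    ‖Matrix.toEuclideanCLM (n := Fin n) (𝕜 := ℝ) A‖ ≤ 16 / 7 * t := by
  set T := Matrix.toEuclideanCLM (n := Fin n) (𝕜 := ℝ) A with hT
  have hinner : ∀ x y : EuclideanSpace ℝ (Fin n),
      inner ℝ x (T y) = ∑ i, ∑ j, x i * y j * A i j := by
    intro x y
    rw [hT, Matrix.inner_toEuclideanCLM]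
    simp only [dotProduct, Matrix.mulVec, Finset.mul_sum]
    exact Finset.sum_congr rfl fun i _ => Finset.sum_congr rfl fun j _ => by ring
  have ht0 : 0 ≤ t := by
    obtain ⟨m, hm, -⟩ := exists_mem_gridNet hn (0 : EuclideanSpace ℝ (Fin n)) (by simp)
    have hneg : -m ∈ gridNet n := by
      rw [gridNet, Finset.mem_filter, Fintype.mem_piFinset] at hm ⊢
      refine ⟨fun i => ?_, ?_⟩
      · have := Finset.mem_Icc.1 (hm.1 i)
        rw [Finset.mem_Icc, Pi.neg_apply]
        omega
      · simpa [neg_div] using hm.2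
    have h1 := h m hm m hm
    have h2 := h m hm (-m) hneg
    simp only [Pi.neg_apply, Int.cast_neg, neg_div, mul_neg, neg_mul,
      Finset.sum_neg_distrib] at h2
    linarith
  have key : ‖T‖ ≤ t + 9 / 16 * ‖T‖ := by
    refine ContinuousLinearMap.opNorm_le_of_re_inner_le (by positivity) fun y x hy hx => ?_
    obtain ⟨m, hm, hmx⟩ := exists_mem_gridNet hn x hx.le
    obtain ⟨m', hm', hmy⟩ := exists_mem_gridNet hn y hy.le
    set x₀ : EuclideanSpace ℝ (Fin n) := WithLp.toLp 2 fun i => (m i : ℝ) / (2 * n) with hx₀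
    set y₀ : EuclideanSpace ℝ (Fin n) := WithLp.toLp 2 fun i => (m' i : ℝ) / (2 * n) with hy₀
    have hsplit : inner ℝ x (T y) =
        inner ℝ x₀ (T y₀) + inner ℝ (x - x₀) (T y) + inner ℝ x₀ (T (y - y₀)) := by
      rw [map_sub, inner_sub_left, inner_sub_right]
      ring
    have h1 : inner ℝ x₀ (T y₀) ≤ t := by
      rw [hinner]
      exact h m hm m' hm'
    have h2 : inner ℝ (x - x₀) (T y) ≤ 1 / 4 * ‖T‖ := by
      refine (real_inner_le_norm _ _).trans ?_
      refine mul_le_mul hmx ?_ (norm_nonneg _) (by norm_num)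
      simpa [hy] using T.le_opNorm y
    have hx₀n : ‖x₀‖ ≤ 5 / 4 := by
      have h1 := norm_sub_norm_le x₀ x
      rw [norm_sub_rev] at h1
      linarith
    have h3 : inner ℝ x₀ (T (y - y₀)) ≤ 5 / 4 * (‖T‖ * (1 / 4)) := by
      refine (real_inner_le_norm _ _).trans ?_
      refine mul_le_mul hx₀n ?_ (norm_nonneg _) (by norm_num)
      exact (T.le_opNorm _).trans (mul_le_mul_of_nonneg_left hmy (norm_nonneg _))
    have h4 : inner ℝ (T y) x = inner ℝ x (T y) := real_inner_comm _ _
    simp only [RCLike.re_to_real]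
    rw [h4, hsplit]
    linarith
  linarith

/-- The hypothesis on the matrix with entries `adjInd G x y - 1 / 2`, from a bound on the grid. -/
lemma abs_sum_adjInd_sub_half_le (hn : 0 < n) (G : SimpleGraph (Fin n)) {η : ℝ} (hη : 2 ≤ η)
    (h : ∀ m ∈ gridNet n, ∀ m' ∈ gridNet n,
      ∑ x, ∑ y, ((m x : ℝ) / (2 * n)) * ((m' y : ℝ) / (2 * n)) * signMatrix G x y ≤ η / 4)
    (u v : Fin n → ℝ) :
    |∑ x, ∑ y, u x * v y * (adjInd G x y - 1 / 2)| ≤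
      η * ((∑ x, u x ^ 2 + ∑ y, v y ^ 2) / 2) := by
  set T := Matrix.toEuclideanCLM (n := Fin n) (𝕜 := ℝ) (signMatrix G) with hT
  have hTn : ‖T‖ ≤ 16 / 7 * (η / 4) := norm_toEuclideanCLM_le_of_gridNet hn _ h
  set x : EuclideanSpace ℝ (Fin n) := WithLp.toLp 2 u with hx
  set y : EuclideanSpace ℝ (Fin n) := WithLp.toLp 2 v with hy
  have hform : ∑ x, ∑ y, u x * v y * (adjInd G x y - 1 / 2) =
      1 / 2 * inner ℝ x (T y) - 1 / 2 * inner ℝ x y := by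
    have h1 : inner ℝ x (T y) = ∑ i, ∑ j, u i * v j * signMatrix G i j := by
      rw [hT, Matrix.inner_toEuclideanCLM]
      simp only [dotProduct, Matrix.mulVec, Finset.mul_sum, hx, hy]
      exact Finset.sum_congr rfl fun i _ => Finset.sum_congr rfl fun j _ => by ring
    have h2 : inner ℝ x y = ∑ i, ∑ j, if i = j then u i * v j else 0 := by
      simp [hx, hy, PiLp.inner_apply, mul_comm]
    rw [h1, h2]
    simp_rw [Finset.mul_sum, ← Finset.sum_sub_distrib]
    refine Finset.sum_congr rfl fun i _ => Finset.sum_congr rfl fun j _ => ?_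
    by_cases hij : i = j
    · subst hij
      simp [signMatrix, adjInd]
      ring
    · simp only [signMatrix, if_neg hij]
      ring
  have h1 : |inner ℝ x (T y)| ≤ 16 / 7 * (η / 4) * (‖x‖ * ‖y‖) := by
    refine (abs_real_inner_le_norm _ _).trans ?_
    have h2 : ‖T y‖ ≤ 16 / 7 * (η / 4) * ‖y‖ := (T.le_opNorm y).trans (by gcongr)
    calc ‖x‖ * ‖T y‖ ≤ ‖x‖ * (16 / 7 * (η / 4) * ‖y‖) := by gcongr
      _ = _ := by ring
  have h2 : |inner ℝ x y| ≤ ‖x‖ * ‖y‖ := abs_real_inner_le_norm x y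
  have hxn : ∑ i, u i ^ 2 = ‖x‖ ^ 2 := by simp [hx, EuclideanSpace.norm_sq_eq]
  have hyn : ∑ i, v i ^ 2 = ‖y‖ ^ 2 := by simp [hy, EuclideanSpace.norm_sq_eq]
  rw [hform, hxn, hyn]
  have h3 := abs_sub (1 / 2 * inner ℝ x (T y)) (1 / 2 * inner ℝ x y)
  rw [abs_mul, abs_mul, abs_of_pos (by norm_num : (0 : ℝ) < 1 / 2)] at h3
  have h4 : ‖x‖ * ‖y‖ ≤ (‖x‖ ^ 2 + ‖y‖ ^ 2) / 2 := by nlinarith [sq_nonneg (‖x‖ - ‖y‖)]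
  have h5 : 0 ≤ ‖x‖ * ‖y‖ := by positivity
  calc _ ≤ (1 / 2 * (16 / 7 * (η / 4)) + 1 / 2) * (‖x‖ * ‖y‖) := by linarith
    _ ≤ η * (‖x‖ * ‖y‖) := by
      refine mul_le_mul_of_nonneg_right ?_ h5
      linarith
    _ ≤ _ := mul_le_mul_of_nonneg_left h4 (by linarith)

end SignMatrix

/-! ### Graphs with pseudorandom edges have no refutation -/

/-- The deterministic part of the argument: `η` bounds the fluctuations of the adjacency matrix
and of the common neighbourhoods. -/
lemma not_hasPSRefutation_of_pseudorandom {n k r : ℕ} (hn : 0 < n) (hr : 1 ≤ r) (hk : 1 ≤ k)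
    {G : SimpleGraph (Fin n)} {η : ℝ} (hη : 0 < η)
    (hA : ∀ u v : Fin n → ℝ, |∑ x, ∑ y, u x * v y * (adjInd G x y - 1 / 2)| ≤
      η * ((∑ x, u x ^ 2 + ∑ y, v y ^ 2) / 2))
    (hB : ∀ W : Finset (Fin n), W.card ≤ 2 * r →
      |((commonNbrs G W).card : ℝ) - Fintype.card (Fin n) / 2 ^ W.card| ≤ η)
    (hsize : (k : ℝ) ^ r * 2 ^ (7 * r ^ 2) * η ≤ n) :
    ¬ HasPSRefutation (cliqueAxioms G k) r := by
  have hne : Nonempty (Fin n) := ⟨⟨0, hn⟩⟩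
  have hn0 : (0 : ℝ) < n := by exact_mod_cast hn
  have hk1 : (1 : ℝ) ≤ k := by exact_mod_cast hk
  have hr2 : r ≤ 2 ^ r := Nat.lt_two_pow_self.le
  have hrsq : r ≤ r ^ 2 := by nlinarith
  have hcount : 0 < extCount G (2 * r) ∅ := by
    have h1 := (abs_le.1 (abs_extCount_sub_extMean_le hη.le hB (2 * r) ∅ (by simp))).1
    have h2 := le_extMean hn0.le (2 * r) (2 * r) 0 (by omega)
    rw [Fintype.card_fin, Finset.card_empty] at h1
    have h3 : ((2 * r : ℕ) : ℝ) * 2 ^ (2 * r * (2 * r)) < 2 ^ (7 * r ^ 2) := by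
      have h4 : 2 * r * 2 ^ (2 * r * (2 * r)) < 2 ^ (7 * r ^ 2) := by
        calc 2 * r * 2 ^ (2 * r * (2 * r)) ≤ 2 * 2 ^ r * 2 ^ (2 * r * (2 * r)) := by gcongr
          _ = 2 ^ (1 + r + 2 * r * (2 * r)) := by ring
          _ < 2 ^ (7 * r ^ 2) := Nat.pow_lt_pow_right (by norm_num) (by nlinarith)
      exact_mod_cast h4
    have h5 : ((2 * r : ℕ) : ℝ) * η * (n : ℝ) ^ (2 * r - 1) < (n / 2 ^ (2 * r)) ^ (2 * r) := by
      rw [div_pow, ← pow_mul, lt_div_iff₀ (by positivity)]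
      have h6 : (n : ℝ) ^ (2 * r) = n * (n : ℝ) ^ (2 * r - 1) := by
        rw [← pow_succ']
        congr 1
        omega
      rw [h6]
      have h7 : ((2 * r : ℕ) : ℝ) * 2 ^ (2 * r * (2 * r)) * η < n := by
        calc _ < 2 ^ (7 * r ^ 2) * η := mul_lt_mul_of_pos_right h3 hη
          _ ≤ (k : ℝ) ^ r * (2 ^ (7 * r ^ 2) * η) :=
            le_mul_of_one_le_left (by positivity) (one_le_pow₀ hk1)
          _ ≤ n := by rw [← mul_assoc]; exact hsize
      calc _ = ((2 * r : ℕ) : ℝ) * 2 ^ (2 * r * (2 * r)) * η * (n : ℝ) ^ (2 * r - 1) := by ring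
        _ < _ := mul_lt_mul_of_pos_right h7 (by positivity)
    linarith
  rcases lt_or_ge k (2 * r) with hlt | hge
  -- here `k.descFactorial` may be too small, but there is an actual clique
  · obtain ⟨T, hT, hTc⟩ := exists_isClique_of_extCount_pos (2 * r) ∅ (by simp) hcount
    obtain ⟨T', hT', hc⟩ := Finset.exists_subset_card_eq (s := T) (n := k)
      (by rw [hTc, Finset.card_empty]; omega)
    rw [← hc]
    exact not_hasPSRefutation_of_isClique r T' (hT.subset (by exact_mod_cast hT'))
  · refine not_hasPSRefutation_of_moment_psd k r (by omega) hcount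
      (moment_quadratic_form_nonneg hη.le hk hA hB ?_)
    rw [Fintype.card_fin]
    have h1 : ((k : ℝ) / 2) ^ r ≤ k.descFactorial r := by
      have h2 : ((k + 1 - r : ℕ) : ℝ) ^ r ≤ k.descFactorial r := by
        exact_mod_cast Nat.pow_sub_le_descFactorial k r
      refine le_trans (pow_le_pow_left₀ (by positivity) ?_ r) h2
      rw [div_le_iff₀ two_pos]
      exact_mod_cast (by omega : k ≤ (k + 1 - r) * 2)
    have h2 := le_extMean hn0.le (2 * r) r r (by omega)
    have h3 : (r : ℝ) ^ 2 * 2 ^ (2 * r + 1 + 2 * r * r) ≤ 2 ^ (7 * r ^ 2) := by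
      have h4 : r ^ 2 * 2 ^ (2 * r + 1 + 2 * r * r) ≤ 2 ^ (7 * r ^ 2) := by
        calc r ^ 2 * 2 ^ (2 * r + 1 + 2 * r * r)
            ≤ (2 ^ r) ^ 2 * 2 ^ (2 * r + 1 + 2 * r * r) := by gcongr
          _ = 2 ^ (4 * r + 1 + 2 * r * r) := by ring
          _ ≤ 2 ^ (7 * r ^ 2) := Nat.pow_le_pow_right (by norm_num) (by nlinarith)
      exact_mod_cast h4
    have h5 : (k : ℝ) ^ r * (r ^ 2 * 2 ^ (2 * r + 1 + 2 * r * r)) * η ≤ n :=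
      le_trans (by gcongr) hsize
    have h6 : (n : ℝ) ^ r = n * (n : ℝ) ^ (r - 1) := by
      rw [← pow_succ']
      congr 1
      omega
    calc 2 ^ r * ((k : ℝ) ^ (2 * r) * (2 * r ^ 2 * η * (n : ℝ) ^ (r - 1)))
        = (k : ℝ) ^ r * (r ^ 2 * 2 ^ (2 * r + 1 + 2 * r * r)) * η *
            ((k : ℝ) ^ r * (n : ℝ) ^ (r - 1) / (2 ^ r * 2 ^ (2 * r * r))) := by
          rw [eq_comm]
          field_simp
          ring
      _ ≤ n * ((k : ℝ) ^ r * (n : ℝ) ^ (r - 1) / (2 ^ r * 2 ^ (2 * r * r))) := by gcongr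
      _ = ((k : ℝ) / 2) ^ r * (n / 2 ^ (2 * r)) ^ r := by
          rw [div_pow, div_pow, ← pow_mul, h6]
          field_simp
      _ ≤ _ := mul_le_mul h1 h2 (by positivity) (by positivity)

/-! ### The probability of a pseudorandom graph -/

section Probability

open MeasureTheory

lemma card_small_sets_le {n : ℕ} (hn : 2 ≤ n) (D : ℕ) :
    ((Finset.range D).biUnion fun j =>
      Finset.powersetCard j (Finset.univ : Finset (Fin n))).card ≤ n ^ D := by
  refine Finset.card_biUnion_le.trans ?_
  refine le_trans (Finset.sum_le_sum (g := fun j => n ^ j) fun j _ => ?_)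
    (Nat.geomSum_lt hn fun j hj => Finset.mem_range.1 hj).le
  rw [Finset.card_powersetCard, Finset.card_univ, Fintype.card_fin]
  exact Nat.choose_le_pow _ _

/-- The random graph violates the codegree condition or the grid condition with small
probability. -/
lemma bad_event_le {n : ℕ} (hn : 2 ≤ n) (D : ℕ) {η : ℝ} (hη : 2 ≤ η) :
    (SimpleGraph.binomialRandom (Fin n) edgeProbHalf).real
      {G | ¬ ((∀ u v : Fin n → ℝ, |∑ x, ∑ y, u x * v y * (adjInd G x y - 1 / 2)| ≤
          η * ((∑ x, u x ^ 2 + ∑ y, v y ^ 2) / 2)) ∧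
        ∀ W : Finset (Fin n), W.card ≤ D →
          |((commonNbrs G W).card : ℝ) - Fintype.card (Fin n) / 2 ^ W.card| ≤ η)} ≤
      (n : ℝ) ^ (D + 1) * (2 * Real.exp (-((η / 2) ^ 2 / (2 * n)))) +
        ((4 * n + 1 : ℝ) ^ n) ^ 2 * Real.exp (-((η / 4) ^ 2 / 16)) := by
  classical
  set μ := SimpleGraph.binomialRandom (Fin n) edgeProbHalf with hμ
  set 𝒰 := (Finset.range D).biUnion fun j =>
    Finset.powersetCard j (Finset.univ : Finset (Fin n)) with h𝒰
  set E₁ : Finset (Fin n) × Fin n → Set (SimpleGraph (Fin n)) := fun e => {G | e.2 ∉ e.1 ∧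
    η / 2 + 1 < |2 * ((commonNbrs G (insert e.2 e.1)).card : ℝ) - (commonNbrs G e.1).card|}
    with hE₁
  set E₂ : (Fin n → ℤ) × (Fin n → ℤ) → Set (SimpleGraph (Fin n)) := fun m => {G | η / 4 ≤
    ∑ x, ∑ y, ((m.1 x : ℝ) / (2 * n)) * ((m.2 y : ℝ) / (2 * n)) * signMatrix G x y} with hE₂
  have hsub : {G : SimpleGraph (Fin n) | ¬ ((∀ u v : Fin n → ℝ,
      |∑ x, ∑ y, u x * v y * (adjInd G x y - 1 / 2)| ≤
          η * ((∑ x, u x ^ 2 + ∑ y, v y ^ 2) / 2)) ∧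
        ∀ W : Finset (Fin n), W.card ≤ D →
          |((commonNbrs G W).card : ℝ) - Fintype.card (Fin n) / 2 ^ W.card| ≤ η)} ⊆
      (⋃ e ∈ 𝒰 ×ˢ (Finset.univ : Finset (Fin n)), E₁ e) ∪
        ⋃ m ∈ gridNet n ×ˢ gridNet n, E₂ m := by
    intro G hG
    by_contra hcon
    rw [Set.mem_union, not_or] at hcon
    obtain ⟨h1, h2⟩ := hcon
    simp only [Set.mem_iUnion, not_exists] at h1 h2
    refine hG ⟨fun u v => abs_sum_adjInd_sub_half_le (by omega) G hη ?_ u v, fun W hW =>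
      abs_card_commonNbrs_sub_le D (by linarith) ?_ W hW⟩
    · intro m hm m' hm'
      exact (not_le.1 (h2 (m, m') (Finset.mem_product.2 ⟨hm, hm'⟩))).le
    · intro U w hU hw
      have hmem : (U, w) ∈ 𝒰 ×ˢ (Finset.univ : Finset (Fin n)) := by
        simp only [h𝒰, Finset.mem_product, Finset.mem_biUnion, Finset.mem_range,
          Finset.mem_powersetCard, Finset.subset_univ, true_and, Finset.mem_univ, and_true]
        exact ⟨_, hU, rfl⟩
      have h3 := not_lt.1 fun h => h1 (U, w) hmem ⟨hw, h⟩
      simp only at h3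
      linarith
  have hP1 : ∀ e, μ.real (E₁ e) ≤ 2 * Real.exp (-((η / 2) ^ 2 / (2 * n))) := by
    rintro ⟨U, w⟩
    by_cases hw : w ∈ U
    · have : E₁ (U, w) = ∅ := Set.eq_empty_of_forall_notMem fun G hG => hG.1 hw
      rw [this, measureReal_empty]
      positivity
    · have h1 := codegree_tail (V := Fin n) (by rw [Fintype.card_fin]; omega) U w hw
        (lam := η / 2) (by linarith)
      rw [Fintype.card_fin] at h1
      exact (measureReal_mono fun G hG => hG.2).trans h1
  have hP2 : ∀ m ∈ gridNet n ×ˢ gridNet n,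
      μ.real (E₂ m) ≤ Real.exp (-((η / 4) ^ 2 / 16)) := by
    intro m hm
    obtain ⟨h1, h2⟩ := Finset.mem_product.1 hm
    exact signMatrix_tail _ _ (Finset.mem_filter.1 h1).2 (Finset.mem_filter.1 h2).2 (by linarith)
  refine (measureReal_mono hsub).trans ((measureReal_union_le _ _).trans (add_le_add ?_ ?_))
  · refine (measureReal_biUnion_finset_le _ _).trans
      ((Finset.sum_le_sum fun e _ => hP1 e).trans ?_)
    rw [Finset.sum_const, nsmul_eq_mul]
    refine mul_le_mul_of_nonneg_right ?_ (by positivity)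
    rw [Finset.card_product, Finset.card_univ, Fintype.card_fin, pow_succ]
    have := card_small_sets_le hn D
    push_cast
    refine mul_le_mul_of_nonneg_right ?_ (by positivity)
    exact_mod_cast this
  · refine (measureReal_biUnion_finset_le _ _).trans ((Finset.sum_le_sum hP2).trans ?_)
    rw [Finset.sum_const, nsmul_eq_mul]
    refine mul_le_mul_of_nonneg_right ?_ (Real.exp_pos _).le
    rw [Finset.card_product, ← sq]
    have := Nat.pow_le_pow_left (card_gridNet_le n) 2
    exact_mod_cast this

/-- With `η = √n log n` and `r ≲ √(log n)`, the failure probability is at most `3 / n`. -/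
lemma failure_probability_le {n r : ℕ} {ℓ : ℝ} (hℓ : Real.log n = ℓ) (hlarge : 1280 ≤ ℓ)
    (hr : 1 ≤ r) (hrn : Real.exp 24 ^ (r ^ 2) * ℓ ≤ √n) :
    (n : ℝ) ^ (2 * r + 1) * (2 * Real.exp (-((√n * ℓ / 2) ^ 2 / (2 * n)))) +
        ((4 * n + 1 : ℝ) ^ n) ^ 2 * Real.exp (-((√n * ℓ / 4) ^ 2 / 16)) ≤ 3 / n := by
  have hn0 : (0 : ℝ) < n := by
    rcases Nat.eq_zero_or_pos n with h | h
    · rw [h] at hℓ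
      simp only [Nat.cast_zero, Real.log_zero] at hℓ
      linarith
    · exact_mod_cast h
  have hexp : (n : ℝ) = Real.exp ℓ := by rw [← hℓ, Real.exp_log hn0]
  have hsqrt : √(n : ℝ) ^ 2 = n := Real.sq_sqrt hn0.le
  have hn5 : (5 : ℝ) ≤ n := by
    have := Real.add_one_le_exp ℓ
    linarith
  have hr24 : 48 * (r : ℝ) ^ 2 ≤ ℓ := by
    have h1 : Real.exp (24 * r ^ 2) ≤ √(n : ℝ) := by
      refine le_trans ?_ hrn
      rw [← Real.exp_nat_mul]
      push_cast
      rw [mul_comm (24 : ℝ)]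
      exact le_mul_of_one_le_right (Real.exp_pos _).le (by linarith)
    have h2 : Real.exp (48 * r ^ 2) ≤ Real.exp ℓ := by
      rw [← hexp, ← hsqrt]
      calc Real.exp (48 * r ^ 2) = Real.exp (24 * r ^ 2) ^ 2 := by
            rw [← Real.exp_nat_mul]
            congr 1
            push_cast
            ring
        _ ≤ _ := pow_le_pow_left₀ (Real.exp_pos _).le h1 2
    exact Real.exp_le_exp.1 h2
  have hr1 : (1 : ℝ) ≤ r := by exact_mod_cast hr
  have e1 : (√(n : ℝ) * ℓ / 2) ^ 2 / (2 * n) = ℓ ^ 2 / 8 := by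
    rw [div_pow, mul_pow, hsqrt]
    field_simp
    norm_num
  have e2 : (√(n : ℝ) * ℓ / 4) ^ 2 / 16 = n * ℓ ^ 2 / 256 := by
    rw [div_pow, mul_pow, hsqrt]
    ring
  have hinv : 3 / (n : ℝ) = 2 * Real.exp (-ℓ) + Real.exp (-ℓ) := by
    rw [Real.exp_neg, ← hexp]
    ring
  rw [e1, e2, hinv]
  refine add_le_add ?_ ?_
  · have h1 : (n : ℝ) ^ (2 * r + 1) = Real.exp ((2 * r + 1) * ℓ) := by
      rw [hexp, ← Real.exp_nat_mul]
      push_cast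
      rfl
    rw [h1, mul_left_comm, ← Real.exp_add]
    refine mul_le_mul_of_nonneg_left (Real.exp_le_exp.2 ?_) zero_le_two
    nlinarith [mul_le_mul_of_nonneg_right (show 16 * (2 * (r : ℝ) + 1) ≤ ℓ by nlinarith)
      (show 0 ≤ ℓ by linarith)]
  · have h1 : ((4 * n + 1 : ℝ) ^ n) ^ 2 ≤ Real.exp (4 * n * ℓ) := by
      have h2 : (4 * n + 1 : ℝ) ≤ Real.exp (2 * ℓ) := by
        rw [two_mul, Real.exp_add, ← hexp]
        nlinarith
      calc ((4 * n + 1 : ℝ) ^ n) ^ 2 ≤ (Real.exp (2 * ℓ) ^ n) ^ 2 := by gcongr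
        _ = Real.exp (4 * n * ℓ) := by
          rw [← pow_mul, ← Real.exp_nat_mul]
          congr 1
          push_cast
          ring
    refine (mul_le_mul_of_nonneg_right h1 (Real.exp_pos _).le).trans ?_
    rw [← Real.exp_add]
    refine Real.exp_le_exp.2 ?_
    have h3 : 5 * ℓ ≤ ℓ ^ 2 / 256 := by nlinarith
    have h4 : (n : ℝ) * (5 * ℓ) ≤ n * (ℓ ^ 2 / 256) := mul_le_mul_of_nonneg_left h3 hn0.le
    nlinarith

end Probability

/-! ### The lower bound for random graphs -/

/-- The `r`-th power of the hypothesis on `k`. -/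
lemma pow_mul_le_sqrt_of_le {n k r : ℕ} {C ℓ : ℝ} (hr : 1 ≤ r) (hC : 0 < C) (hℓ : 0 < ℓ)
    (h : (k : ℝ) ≤ (n : ℝ) ^ (1 / (2 * (r : ℝ))) / (C ^ r * ℓ ^ (1 / (r : ℝ)))) :
    (k : ℝ) ^ r * (C ^ (r ^ 2) * ℓ) ≤ √n := by
  have hr0 : (r : ℝ) ≠ 0 := by
    have : r ≠ 0 := by omega
    exact_mod_cast this
  have h1 : ((n : ℝ) ^ (1 / (2 * (r : ℝ)))) ^ r = √n := by
    rw [← Real.rpow_natCast, ← Real.rpow_mul (by positivity), Real.sqrt_eq_rpow]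
    congr 1
    field_simp
  have h2 : (ℓ ^ (1 / (r : ℝ))) ^ r = ℓ := by
    rw [← Real.rpow_natCast, ← Real.rpow_mul hℓ.le, one_div_mul_cancel hr0, Real.rpow_one]
  rw [le_div_iff₀ (by positivity)] at h
  have h3 := pow_le_pow_left₀ (by positivity) h r
  rw [mul_pow, mul_pow, h1, h2, ← pow_mul, ← sq] at h3
  exact h3

theorem theorem1p3 :
    ∃ C : ℝ, 0 < C ∧ ∀ ε : ℝ, 0 < ε → ∃ n₀ : ℕ, ∀ n : ℕ, n₀ ≤ n → ∀ r : ℕ, 1 ≤ r →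
      1 - ε ≤ (SimpleGraph.binomialRandom (Fin n) edgeProbHalf).real
        {G : SimpleGraph (Fin n) | ∀ k : ℕ,
          (k : ℝ) ≤ (n : ℝ) ^ (1 / (2 * (r : ℝ))) /
              (C ^ r * Real.log (n : ℝ) ^ (1 / (r : ℝ))) →
            ¬ HasPSRefutation (cliqueAxioms G k) r} := by
  -- `C = e ^ 24` makes `48 r² ≤ log n` whenever `k = 1` is allowed, which pays for the union bound
  -- over `n ^ (2r + 1)` codegree conditions
  refine ⟨Real.exp 24, Real.exp_pos _, fun ε hε => ?_⟩
  obtain ⟨N₁, hN₁⟩ := exists_nat_ge (Real.exp 1280)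
  obtain ⟨N₂, hN₂⟩ := exists_nat_ge (3 / ε)
  refine ⟨max N₁ N₂, fun n hn r hr => ?_⟩
  have hn1 : Real.exp 1280 ≤ n := hN₁.trans (by exact_mod_cast (le_max_left _ _).trans hn)
  have hn2 : 3 / ε ≤ n := hN₂.trans (by exact_mod_cast (le_max_right _ _).trans hn)
  have hn1281 : (1281 : ℝ) ≤ n := by
    have := Real.add_one_le_exp (1280 : ℝ)
    linarith
  have hn0 : (0 : ℝ) < n := by linarith
  have hnat : 2 ≤ n := by
    have : (2 : ℝ) ≤ n := by linarith
    exact_mod_cast this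
  set ℓ := Real.log (n : ℝ) with hℓ
  have hlarge : 1280 ≤ ℓ := (Real.le_log_iff_exp_le hn0).2 hn1
  set μ := SimpleGraph.binomialRandom (Fin n) edgeProbHalf with hμ
  set good : Set (SimpleGraph (Fin n)) := {G | ∀ k : ℕ,
    (k : ℝ) ≤ (n : ℝ) ^ (1 / (2 * (r : ℝ))) / (Real.exp 24 ^ r * ℓ ^ (1 / (r : ℝ))) →
      ¬ HasPSRefutation (cliqueAxioms G k) r} with hgood
  have hzero : ∀ G : SimpleGraph (Fin n), ¬ HasPSRefutation (cliqueAxioms G 0) r := fun G =>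
    not_hasPSRefutation_of_isClique (G := G) r ∅ (by simp)
  by_cases hrn : Real.exp 24 ^ (r ^ 2) * ℓ ≤ √n
  · set η := √(n : ℝ) * ℓ with hη
    have hsqrt1 : 1 ≤ √(n : ℝ) := Real.one_le_sqrt.2 (by linarith)
    have hη2 : 2 ≤ η := by nlinarith
    have hbad := (bad_event_le hnat (2 * r) hη2).trans
      (failure_probability_le hℓ.symm hlarge hr hrn)
    rw [← hμ] at hbad
    set bad : Set (SimpleGraph (Fin n)) := {G | ¬ ((∀ u v : Fin n → ℝ,
      |∑ x, ∑ y, u x * v y * (adjInd G x y - 1 / 2)| ≤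
          η * ((∑ x, u x ^ 2 + ∑ y, v y ^ 2) / 2)) ∧
        ∀ W : Finset (Fin n), W.card ≤ 2 * r →
          |((commonNbrs G W).card : ℝ) - Fintype.card (Fin n) / 2 ^ W.card| ≤ η)} with hbaddef
    have hcover : Set.univ ⊆ good ∪ bad := by
      intro G _
      by_cases hG : G ∈ bad
      · exact Or.inr hG
      · left
        obtain ⟨hA, hB⟩ := not_not.1 hG
        intro k hk
        rcases Nat.eq_zero_or_pos k with rfl | hkpos
        · exact hzero G
        · refine not_hasPSRefutation_of_pseudorandom (by omega) hr hkpos (by linarith) hA hB ?_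
          have h1 := pow_mul_le_sqrt_of_le hr (Real.exp_pos 24) (by linarith) hk
          have h2 : (2 : ℝ) ^ (7 * r ^ 2) ≤ Real.exp 24 ^ (r ^ 2) := by
            rw [pow_mul]
            refine pow_le_pow_left₀ (by positivity) ?_ _
            have h3 : (2 : ℝ) ^ 7 ≤ Real.exp 1 ^ 7 := by
              refine pow_le_pow_left₀ zero_le_two ?_ 7
              linarith [Real.add_one_le_exp (1 : ℝ)]
            refine h3.trans ?_
            rw [← Real.exp_nat_mul]
            exact Real.exp_le_exp.2 (by norm_num)
          calc (k : ℝ) ^ r * 2 ^ (7 * r ^ 2) * η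
              ≤ (k : ℝ) ^ r * Real.exp 24 ^ (r ^ 2) * η := by gcongr
            _ = ((k : ℝ) ^ r * (Real.exp 24 ^ (r ^ 2) * ℓ)) * √n := by
                rw [hη]
                ring
            _ ≤ √n * √n := by gcongr
            _ = n := Real.mul_self_sqrt hn0.le
    have h1 : 1 ≤ μ.real good + μ.real bad := by
      calc (1 : ℝ) = μ.real Set.univ := MeasureTheory.probReal_univ.symm
        _ ≤ μ.real (good ∪ bad) := MeasureTheory.measureReal_mono hcover
        _ ≤ _ := MeasureTheory.measureReal_union_le _ _
    have h2 : 3 / (n : ℝ) ≤ ε := by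
      rw [div_le_iff₀ hn0]
      rwa [div_le_iff₀ hε, mul_comm] at hn2
    linarith
  · -- the bound on `k` is then below one, so that only `k = 0` is left
    have huniv : good = Set.univ := by
      refine Set.eq_univ_of_forall fun G k hk => ?_
      rcases Nat.eq_zero_or_pos k with rfl | hkpos
      · exact hzero G
      · exfalso
        have h1 := pow_mul_le_sqrt_of_le hr (Real.exp_pos 24) (by linarith) hk
        have h2 : (1 : ℝ) ≤ (k : ℝ) ^ r := one_le_pow₀ (by exact_mod_cast hkpos)
        exact hrn (le_trans (le_mul_of_one_le_left (by positivity) h2) h1)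
    rw [huniv, MeasureTheory.probReal_univ]
    linarith
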